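/- Let $d \ge 0$ be an integer and let $f : \mathbb{R}^d \to (-\infty, +\infty]$ be convex with $0 < \int_{\mathbb{R}^d} e^{-f(x)}\,dx < \infty$. Let $f^*(y) = \sup_{x \in \mathbb{R}^d} \left( \langle x, y\rangle - f(x) \right)$ be its Legendre transform, and let $$\mu = \frac{e^{-f}\,dx}{\int e^{-f}\,dx}, \qquad \mu^* = \frac{e^{-f^*}\,dx}{\int e^{-f^*}\,dx}$$ be the probability measures with densities proportional to $e^{-f}$ and $e^{-f^*}$. Assume that the log-concave measure $\mu$ is unconditional, i.e. invariant under the reflection $x_i \mapsto -x_i$ for every $i \in \{1,\dots,d\}$. Then $0 < \int e^{-f^*}\,dx < \infty$ (so that $\mu^*$ is well defined), and $$\mathrm{Ent}_\gamma(\mu) + \mathrm{Ent}_\gamma(\mu^*) \le \frac{1}{2} W_2(\mu, \mu^*)^2 + d \log(\pi/2),$$ where $\gamma$ is the standard Gaussian measure on $\mathbb{R}^d$, $\mathrm{Ent}_\gamma(\nu) = \int \log\frac{d\nu}{d\gamma}\,d\nu$ is the relative entropy with respect to $\gamma$, and $W_2(\mu,\nu)^2 = \inf_\pi \int |x-y|^2\,d\pi(x,y)$,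 the infimum being over all couplings $\pi$ of $\mu$ and $\nu$. -/

import Mathlib

open MeasureTheory ProbabilityTheory InformationTheory
open scoped ENNReal

noncomputable section

namespace ReverseTalagrand

/-- The reflection `(x₁, …, x_d) ↦ (x₁, …, -x_i, …, x_d)` with respect to the hyperplane
`{x_i = 0}`. -/
def coordReflection {d : ℕ} (i : Fin d) (x : EuclideanSpace ℝ (Fin d)) :
    EuclideanSpace ℝ (Fin d) :=
  WithLp.toLp 2 (Function.update (fun j => x j) i (-x i))

/-- A measure on `ℝ^d` is unconditional if it is invariant under all coordinate reflections. -/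
def IsUnconditional {d : ℕ} (μ : Measure (EuclideanSpace ℝ (Fin d))) : Prop :=
  ∀ i : Fin d, μ.map (coordReflection i) = μ

/-- Convexity of an extended-real-valued function: its epigraph in `ℝ^d × ℝ` is convex. -/
def IsConvexFun {d : ℕ} (f : EuclideanSpace ℝ (Fin d) → EReal) : Prop :=
  Convex ℝ {p : EuclideanSpace ℝ (Fin d) × ℝ | f p.1 ≤ (p.2 : EReal)}

/-- The Legendre transform `f*(y) = sup_x (⟨x, y⟩ - f x)`. -/
def legendre {d : ℕ} (f : EuclideanSpace ℝ (Fin d) → EReal) :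
    EuclideanSpace ℝ (Fin d) → EReal :=
  fun y => ⨆ x : EuclideanSpace ℝ (Fin d), ((inner ℝ x y : ℝ) : EReal) - f x

/-- The total mass `∫ e^{-f} dx`, with `e^{-∞} = 0`. -/
def expMass {d : ℕ} (f : EuclideanSpace ℝ (Fin d) → EReal) : ℝ≥0∞ :=
  ∫⁻ x, EReal.exp (-f x)

/-- The measure `e^{-f} dx`, normalized to total mass one (for `0 < ∫ e^{-f} dx < ∞`). -/
def expMeasure {d : ℕ} (f : EuclideanSpace ℝ (Fin d) → EReal) :
    Measure (EuclideanSpace ℝ (Fin d)) :=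
  (expMass f)⁻¹ • (volume : Measure (EuclideanSpace ℝ (Fin d))).withDensity
    (fun x => EReal.exp (-f x))

/-- The couplings of two measures: measures on the product with the given marginals. -/
def couplings {d : ℕ} (μ ν : Measure (EuclideanSpace ℝ (Fin d))) :
    Set (Measure (EuclideanSpace ℝ (Fin d) × EuclideanSpace ℝ (Fin d))) :=
  {p | p.map Prod.fst = μ ∧ p.map Prod.snd = ν}

/-- The quadratic Kantorovich-Wasserstein distance. -/
def wassersteinTwo {d : ℕ} (μ ν : Measure (EuclideanSpace ℝ (Fin d))) : ℝ≥0∞ :=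
  (⨅ p ∈ couplings μ ν, ∫⁻ z, edist z.1 z.2 ^ 2 ∂p) ^ (1 / 2 : ℝ)

/-- The relative entropy `Ent_γ(μ)` with respect to the standard Gaussian measure `γ`. -/
def gaussianEntropy {d : ℕ} (μ : Measure (EuclideanSpace ℝ (Fin d))) : ℝ≥0∞ :=
  klDiv μ (stdGaussian (EuclideanSpace ℝ (Fin d)))

end ReverseTalagrand

end

/-! Write g = f** and h = f*. Expanding the entropies gives Ent_γ(μ) + Ent_γ(μ*) = ½(∫|x|² dμ +
∫|y|² dμ*) - ∫g dμ - ∫h dμ* + d log(2π) - log(∫e^{-g} ∫e^{-h}). Under any coupling, the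
Fenchel–Young inequality ⟨x, y⟩ ≤ g(x) + h(y) bounds the first terms by half the transport cost
(`ofReal_le_wassersteinTwo_sq`). It remains to show ∫e^{-g} ∫e^{-h} ≥ 4^d, since 2π/4 = π/2.

This inverse Santaló inequality (`four_pow_le_expMass_mul`) reduces by symmetry to the positive
orthant, where the product of the two integrals must be at least 1 = ∫e^{-∑aᵢ} da. Minimizing g(x) -
∑aᵢ log xᵢ factors every positive a as aᵢ = xᵢyᵢ with g(x) + h(y) ≤ ∑aᵢ (`exists_factorization`). So
each superlevel set of e^{-∑aᵢ} lies in the set of coordinatewise products of pairs from the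
corresponding superlevel set of e^{-g(x)-h(y)}. Passing to products does not increase the volume of
a lower set (`volume_mulSet_le`), and integrating over levels concludes.

The hypothesis only makes f symmetric almost everywhere. For convex f of positive mass the Legendre
transform is an essential supremum, so f* and f** are exactly symmetric, and f** = f almost
everywhere. -/

namespace ReverseTalagrand

variable {d : ℕ}

/-! ### Legendre duality and almost everywhere biconjugation -/

section Legendre

variable {f g : EuclideanSpace ℝ (Fin d) → EReal}

/-- Reduces inequalities between Legendre transforms to real epigraph bounds, avoiding arithmetic
with infinite values. -/
theorem ereal_le_of_forall_coe {a b : EReal} (h : ∀ c : ℝ, b ≤ c → a ≤ c) : a ≤ b := by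
  induction b with
  | top => exact le_top
  | coe b => exact h b le_rfl
  | bot =>
    refine le_of_eq (EReal.eq_bot_iff_forall_lt a |>.2 fun y => ?_)
    refine (h (y - 1) bot_le).trans_lt ?_
    exact_mod_cast sub_one_lt y

/-- A bound on the Legendre transform, expressed through the epigraph. -/
theorem legendre_le_coe_iff {y : EuclideanSpace ℝ (Fin d)} {c : ℝ} :
    legendre f y ≤ c ↔ ∀ x, ∀ r : ℝ, f x ≤ r → inner ℝ x y - r ≤ c := by
  unfold legendre
  rw [iSup_le_iff]
  refine forall_congr' fun x => ?_
  induction f x with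
  | top => simp
  | coe b =>
    rw [← EReal.coe_sub, EReal.coe_le_coe_iff]
    constructor
    · intro h r hr
      have := EReal.coe_le_coe_iff.1 hr
      linarith
    · intro h
      exact h b le_rfl
  | bot =>
    simp only [bot_le, forall_const]
    constructor
    · intro h
      simp at h
    · intro h
      have := h (inner ℝ x y - c - 1)
      linarith

theorem inner_le_of_legendre_le {x y : EuclideanSpace ℝ (Fin d)} {r s : ℝ}
    (hx : f x ≤ r) (hy : legendre f y ≤ s) : inner ℝ x y ≤ r + s := by
  have := legendre_le_coe_iff.1 hy x r hx
  linarith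

theorem legendre_legendre_le (x : EuclideanSpace ℝ (Fin d)) :
    legendre (legendre f) x ≤ f x := by
  refine ereal_le_of_forall_coe fun c hc => legendre_le_coe_iff.2 fun y s hs => ?_
  have := inner_le_of_legendre_le hc hs
  rw [real_inner_comm]
  linarith

theorem legendre_antitone (h : ∀ x, f x ≤ g x) (y : EuclideanSpace ℝ (Fin d)) :
    legendre g y ≤ legendre f y :=
  ereal_le_of_forall_coe fun _ hc => legendre_le_coe_iff.2 fun x r hr =>
    legendre_le_coe_iff.1 hc x r ((h x).trans hr)

theorem legendre_legendre_legendre : legendre (legendre (legendre f)) = legendre f :=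
  funext fun y => le_antisymm (legendre_legendre_le y)
    (legendre_antitone (fun x => legendre_legendre_le x) y)

theorem isConvexFun_legendre : IsConvexFun (legendre f) := by
  rintro ⟨y, r⟩ hy ⟨z, s⟩ hz a b ha hb hab
  simp only [Set.mem_ofPred_eq, Prod.smul_mk, Prod.mk_add_mk, smul_eq_mul] at *
  refine legendre_le_coe_iff.2 fun x t ht => ?_
  have h1 := legendre_le_coe_iff.1 hy x t ht
  have h2 := legendre_le_coe_iff.1 hz x t ht
  rw [inner_add_right, inner_smul_right, inner_smul_right]
  have : t = a * t + b * t := by rw [← add_mul, hab, one_mul]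
  nlinarith [mul_le_mul_of_nonneg_left h1 ha, mul_le_mul_of_nonneg_left h2 hb]

/-- The epigraph is an intersection of closed half-spaces, one for each epigraph point of `f`. -/
theorem isClosed_epigraph_legendre :
    IsClosed {p : EuclideanSpace ℝ (Fin d) × ℝ | legendre f p.1 ≤ (p.2 : EReal)} := by
  have : {p : EuclideanSpace ℝ (Fin d) × ℝ | legendre f p.1 ≤ (p.2 : EReal)} =
      ⋂ (x : EuclideanSpace ℝ (Fin d)) (r : ℝ) (_ : f x ≤ r), {p | inner ℝ x p.1 - r ≤ p.2} := by
    ext p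
    simp only [Set.mem_ofPred_eq, Set.mem_iInter]
    exact legendre_le_coe_iff
  rw [this]
  exact isClosed_iInter fun x => isClosed_iInter fun r => isClosed_iInter fun _ =>
    isClosed_le (by fun_prop) (by fun_prop)

theorem measurable_legendre : Measurable (legendre f) := by
  refine measurable_of_Iio fun a => ?_
  have : legendre f ⁻¹' Set.Iio a = ⋃ (q : ℚ) (_ : ((q : ℝ) : EReal) < a),
      {y | legendre f y ≤ ((q : ℝ) : EReal)} := by
    ext y
    simp only [Set.mem_preimage, Set.mem_Iio, Set.mem_iUnion, Set.mem_ofPred_eq, exists_prop]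
    constructor
    · intro h
      obtain ⟨q, h1, h2⟩ := EReal.exists_rat_btwn_of_lt h
      exact ⟨q, h2, h1.le⟩
    · rintro ⟨q, h1, h2⟩
      exact h2.trans_lt h1
  rw [this]
  refine MeasurableSet.iUnion fun q => MeasurableSet.iUnion fun _ => IsClosed.measurableSet ?_
  exact isClosed_epigraph_legendre.preimage (f := fun y => (y, (q : ℝ))) (by fun_prop)

theorem convex_domain (hf : IsConvexFun f) : Convex ℝ {x | f x < ⊤} := by
  have : {x | f x < ⊤} = Prod.fst '' {p : EuclideanSpace ℝ (Fin d) × ℝ | f p.1 ≤ (p.2 : EReal)} := by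
    ext x
    simp only [Set.mem_ofPred_eq, Set.mem_image, Prod.exists, exists_and_right, exists_eq_right]
    constructor
    · intro h
      obtain ⟨q, h1, h2⟩ := EReal.exists_rat_btwn_of_lt h
      exact ⟨q, h1.le⟩
    · rintro ⟨r, hr⟩
      exact hr.trans_lt (EReal.coe_lt_top r)
  rw [this]
  exact hf.linear_image (LinearMap.fst ℝ _ _)

/-- The set where `f < ⊤` carries all the mass and is the union of these sets over `n`. One of them
serves as the body contracted in `legendre_le_of_ae`. -/
theorem exists_volume_ne_zero (hpos : expMass f ≠ 0) (y : EuclideanSpace ℝ (Fin d)) :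
    ∃ n : ℕ, volume {x | f x ≤ ((n : ℝ) : EReal) ∧ -(n : ℝ) ≤ inner ℝ x y} ≠ 0 := by
  by_contra! h
  apply hpos
  have h1 : ∀ᵐ x : EuclideanSpace ℝ (Fin d), ∀ n : ℕ,
      ¬ (f x ≤ ((n : ℝ) : EReal) ∧ -(n : ℝ) ≤ inner ℝ x y) := by
    rw [ae_all_iff]
    intro n
    rw [ae_iff]
    simpa using h n
  have h2 : (fun x => EReal.exp (-f x)) =ᵐ[volume] fun _ => 0 := by
    filter_upwards [h1] with x hx
    rw [EReal.exp_eq_zero_iff, EReal.neg_eq_bot_iff]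
    by_contra hne
    have hlt := lt_top_iff_ne_top.2 hne
    obtain ⟨q, hq, -⟩ := EReal.exists_rat_btwn_of_lt hlt
    obtain ⟨n, hn⟩ := exists_nat_ge (max (q : ℝ) (-inner ℝ x y))
    refine hx n ⟨hq.le.trans (EReal.coe_le_coe_iff.2 ((le_max_left _ _).trans hn)), ?_⟩
    linarith [(le_max_right (q : ℝ) (-inner ℝ x y)).trans hn]
  unfold expMass
  rw [lintegral_congr_ae h2]
  simp

/-- For a convex function with nonzero mass, the supremum defining the Legendre transform
is an essential supremum. -/
theorem legendre_le_of_ae (hf : IsConvexFun f) (hpos : expMass f ≠ 0)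
    {y : EuclideanSpace ℝ (Fin d)} {c : ℝ}
    (h : ∀ᵐ x : EuclideanSpace ℝ (Fin d), ∀ r : ℝ, f x ≤ r → inner ℝ x y - r ≤ c) :
    legendre f y ≤ c := by
  refine legendre_le_coe_iff.2 fun x₀ r₀ hr₀ => ?_
  by_contra! hlt
  obtain ⟨n, hn⟩ := exists_volume_ne_zero hpos y
  set δ := inner ℝ x₀ y - r₀ - c with hδ
  have hδ0 : 0 < δ := by linarith
  -- At `(1 - t) x₀ + t x` with `x ∈ S`, convexity gives a value at least `(1 - t)(δ + c) - 2tn`;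
  -- this choice of `t` keeps it above `c`.
  obtain ⟨t, ht0, ht1, ht⟩ : ∃ t : ℝ, 0 < t ∧ t ≤ 1 ∧ t * (δ + c + 2 * n) < δ := by
    refine ⟨min 1 (δ / (2 * (|δ + c + 2 * n| + 1))), by positivity, min_le_left _ _, ?_⟩
    set M := |δ + c + 2 * n| with hM
    have hM0 : 0 ≤ M := abs_nonneg _
    calc min 1 (δ / (2 * (M + 1))) * (δ + c + 2 * n)
        ≤ min 1 (δ / (2 * (M + 1))) * M :=
          mul_le_mul_of_nonneg_left (le_abs_self _) (by positivity)
      _ ≤ δ / (2 * (M + 1)) * M := mul_le_mul_of_nonneg_right (min_le_right _ _) hM0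
      _ < δ := by
        rw [div_mul_eq_mul_div, div_lt_iff₀ (by positivity)]
        nlinarith
  set S := {x | f x ≤ ((n : ℝ) : EReal) ∧ -(n : ℝ) ≤ inner ℝ x y} with hS
  -- The contracted copy of `S` violates the bound everywhere, yet has volume `t ^ d` times that of
  -- `S`, which is positive.
  have hsub : AffineMap.homothety x₀ t '' S ⊆
      {x | ¬ ∀ r : ℝ, f x ≤ r → inner ℝ x y - r ≤ c} := by
    rintro _ ⟨x, ⟨hx1, hx2⟩, rfl⟩ hcon
    have hmem := hf (x := (x₀, r₀)) (by exact hr₀) (y := (x, (n : ℝ))) (by exact hx1)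
      (a := 1 - t) (b := t) (by linarith) ht0.le (by ring)
    simp only [Set.mem_ofPred_eq, Prod.smul_mk, Prod.mk_add_mk, smul_eq_mul] at hmem
    have heq : AffineMap.homothety x₀ t x = (1 - t) • x₀ + t • x := by
      rw [AffineMap.homothety_apply, vsub_eq_sub, vadd_eq_add, smul_sub, sub_smul, one_smul]
      abel
    have := hcon _ (heq ▸ hmem)
    rw [heq, inner_add_left, real_inner_smul_left, real_inner_smul_left] at this
    nlinarith
  have h0 : volume (AffineMap.homothety x₀ t '' S) = 0 := measure_mono_null hsub (ae_iff.1 h)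
  rw [Measure.addHaar_image_homothety, mul_eq_zero] at h0
  rcases h0 with h0 | h0
  · rw [ENNReal.ofReal_eq_zero] at h0
    have : 0 < |t ^ Module.finrank ℝ (EuclideanSpace ℝ (Fin d))| := by positivity
    linarith
  · exact hn h0

/-- Hahn–Banach separates `(x₀, f x₀)` from the open strict epigraph over the interior of the
domain. The normal has negative vertical component `c`, and dividing by `-c` gives the slope. -/
theorem exists_subgradient (hbot : ∀ x, f x ≠ ⊥) (hf : IsConvexFun f) (hpos : expMass f ≠ 0)
    {x₀ : EuclideanSpace ℝ (Fin d)} (hx₀ : x₀ ∈ interior {x | f x < ⊤}) :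
    ∃ y, legendre f y ≤ ((inner ℝ x₀ y - (f x₀).toReal : ℝ) : EReal) := by
  set A := {x | f x < ⊤} with hA
  have hAc : Convex ℝ A := convex_domain hf
  set F : EuclideanSpace ℝ (Fin d) → ℝ := fun x => (f x).toReal with hF
  have hcoe : ∀ x ∈ A, f x = F x := fun x hx =>
    (EReal.coe_toReal (ne_of_lt hx) (hbot x)).symm
  have hFc : ConvexOn ℝ (interior A) F := by
    refine ⟨hAc.interior, fun x hx y hy a b ha hb hab => ?_⟩
    have h := hf (x := (x, F x)) (hcoe x (interior_subset hx)).le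
      (y := (y, F y)) (hcoe y (interior_subset hy)).le ha hb hab
    simp only [Set.mem_ofPred_eq, Prod.smul_mk, Prod.mk_add_mk] at h
    rw [hcoe _ (interior_subset (hAc.interior hx hy ha hb hab))] at h
    exact EReal.coe_le_coe_iff.1 h
  have hFcont : ContinuousOn F (interior A) := hFc.continuousOn isOpen_interior
  set S := {p : EuclideanSpace ℝ (Fin d) × ℝ | p.1 ∈ interior A ∧ F p.1 < p.2} with hS
  have hSc : Convex ℝ S := hFc.convex_strict_epigraph
  have hSo : IsOpen S := by
    have h1 : ContinuousOn (fun p : EuclideanSpace ℝ (Fin d) × ℝ => p.2 - F p.1)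
        (interior A ×ˢ Set.univ) :=
      continuousOn_snd.sub (hFcont.comp continuousOn_fst fun p hp => hp.1)
    have h2 := h1.isOpen_inter_preimage (isOpen_interior.prod isOpen_univ) (isOpen_Ioi (a := (0 : ℝ)))
    convert h2 using 1
    ext p
    simp [hS]
  obtain ⟨φ, hφ⟩ := geometric_hahn_banach_open_point hSc hSo
    (x := (x₀, F x₀)) (fun h => lt_irrefl _ h.2)
  set ψ : EuclideanSpace ℝ (Fin d) →L[ℝ] ℝ := φ.comp (ContinuousLinearMap.inl ℝ _ ℝ) with hψ
  have hsplit : ∀ z t, φ (z, t) = ψ z + t * φ (0, 1) := by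
    intro z t
    have : (z, t) = (z, (0 : ℝ)) + t • ((0 : EuclideanSpace ℝ (Fin d)), (1 : ℝ)) := by simp
    rw [this, map_add, map_smul, smul_eq_mul]
    rfl
  set c := φ (0, 1) with hc
  have hc0 : c < 0 := by
    have := hφ (x₀, F x₀ + 1) ⟨hx₀, by simp⟩
    rw [hsplit, hsplit] at this
    linarith
  have hsub : ∀ z ∈ interior A, ψ z + F z * c ≤ ψ x₀ + F x₀ * c := by
    intro z hz
    refine le_of_forall_pos_le_add fun ε hε => ?_
    have := hφ (z, F z + ε / (-c)) ⟨hz, by simp [div_pos hε (neg_pos.2 hc0)]⟩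
    rw [hsplit, hsplit, add_mul] at this
    have h3 : ε / (-c) * c = -ε := by
      rw [div_neg, neg_mul, div_mul_cancel₀ _ hc0.ne]
    linarith
  set y := (InnerProductSpace.toDual ℝ (EuclideanSpace ℝ (Fin d))).symm ((-c)⁻¹ • ψ) with hy
  have hyi : ∀ z, inner ℝ z y = (-c)⁻¹ * ψ z := by
    intro z
    rw [real_inner_comm, hy, InnerProductSpace.toDual_symm_apply]
    rfl
  -- Separation controls only interior points of the domain; the frontier of a convex set is null,
  -- so the almost everywhere criterion suffices.
  refine ⟨y, legendre_le_of_ae hf hpos ?_⟩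
  have hfr : ∀ᵐ z : EuclideanSpace ℝ (Fin d), z ∉ frontier A := by
    rw [ae_iff]
    simpa using hAc.addHaar_frontier volume
  filter_upwards [hfr] with z hz r hr
  have hzA : z ∈ A := hr.trans_lt (EReal.coe_lt_top r)
  have hzi : z ∈ interior A := by
    by_contra hcon
    exact hz ⟨subset_closure hzA, hcon⟩
  have hr' : F z ≤ r := by
    rw [hcoe z hzA] at hr
    exact EReal.coe_le_coe_iff.1 hr
  have h1 := mul_le_mul_of_nonneg_left (hsub z hzi) (inv_nonneg.2 (neg_nonneg.2 hc0.le))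
  rw [hyi, hyi]
  have h2 : ∀ u : ℝ, (-c)⁻¹ * (u * c) = -u := by
    intro u
    rw [inv_neg, neg_mul, mul_comm u, inv_mul_cancel_left₀ hc0.ne]
  rw [mul_add, mul_add, h2, h2] at h1
  linarith

theorem interior_domain_nonempty (hf : IsConvexFun f) (hpos : expMass f ≠ 0) :
    (interior {x | f x < ⊤}).Nonempty := by
  by_contra hne
  obtain ⟨n, hn⟩ := exists_volume_ne_zero hpos 0
  apply hn
  refine measure_mono_null ?_ ((convex_domain hf).addHaar_frontier volume)
  intro x hx
  rw [frontier, Set.not_nonempty_iff_eq_empty.1 hne, Set.sdiff_empty]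
  exact subset_closure (hx.1.trans_lt (EReal.coe_lt_top _))

/-- A convex function of nonzero mass agrees almost everywhere with its biconjugate. -/
theorem legendre_legendre_ae_eq (hbot : ∀ x, f x ≠ ⊥) (hf : IsConvexFun f)
    (hpos : expMass f ≠ 0) : legendre (legendre f) =ᵐ[volume] f := by
  have hAc := convex_domain hf
  have hfr : ∀ᵐ z : EuclideanSpace ℝ (Fin d), z ∉ frontier {x | f x < ⊤} := by
    rw [ae_iff]
    simpa using hAc.addHaar_frontier volume
  filter_upwards [hfr] with x hx
  refine le_antisymm (legendre_legendre_le x) (ereal_le_of_forall_coe fun c hc => ?_)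
  rw [legendre_le_coe_iff] at hc
  by_cases hxi : x ∈ interior {x | f x < ⊤}
  · obtain ⟨y, hy⟩ := exists_subgradient hbot hf hpos hxi
    have := hc y _ hy
    rw [real_inner_comm] at this
    have hlt : f x < ⊤ := interior_subset (s := {x | f x < ⊤}) hxi
    rw [← EReal.coe_toReal hlt.ne (hbot x), EReal.coe_le_coe_iff]
    linarith
  · exfalso
    have hxc : x ∉ closure {x | f x < ⊤} := fun h => hx ⟨h, hxi⟩
    obtain ⟨x₁, hx₁⟩ := interior_domain_nonempty hf hpos
    obtain ⟨y₁, hy₁⟩ := exists_subgradient hbot hf hpos hx₁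
    set s₁ := inner ℝ x₁ y₁ - (f x₁).toReal
    obtain ⟨φ, u, hφ, hu⟩ := geometric_hahn_banach_closed_point hAc.closure isClosed_closure hxc
    set p := (InnerProductSpace.toDual ℝ (EuclideanSpace ℝ (Fin d))).symm φ with hp
    have hpi : ∀ z, inner ℝ z p = φ z := by
      intro z
      rw [real_inner_comm, hp, InnerProductSpace.toDual_symm_apply]
    -- Along the ray `y₁ + t p`, with `p` separating `x` from the domain, `f*` grows at rate at most
    -- `u < φ x`. Hence `f**` is infinite at `x`, contradicting the bound `c`.
    have key : ∀ t : ℝ, 0 ≤ t → t * (φ x - u) ≤ c + s₁ - inner ℝ x y₁ := by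
      intro t ht
      have h1 : legendre f (y₁ + t • p) ≤ ((s₁ + t * u : ℝ) : EReal) := by
        refine legendre_le_coe_iff.2 fun z r hr => ?_
        have h2 := legendre_le_coe_iff.1 hy₁ z r hr
        have h3 := hφ z (subset_closure (hr.trans_lt (EReal.coe_lt_top _)))
        rw [inner_add_right, inner_smul_right, hpi]
        nlinarith
      have h4 := hc _ _ h1
      rw [real_inner_comm, inner_add_right, inner_smul_right, hpi] at h4
      linarith
    have hpos' : 0 < φ x - u := by linarith
    have := key ((|c + s₁ - inner ℝ x y₁| + 1) / (φ x - u)) (by positivity)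
    rw [div_mul_cancel₀ _ hpos'.ne'] at this
    linarith [le_abs_self (c + s₁ - inner ℝ x y₁)]

end Legendre

/-! ### Volume of coordinatewise products -/

/-- The set of coordinatewise products of the points of a set of pairs. -/
def mulSet {d : ℕ} (U : Set (Fin d → ℝ × ℝ)) : Set (Fin d → ℝ) :=
  {a | ∃ x : Fin d → ℝ, (∀ i, 0 < x i) ∧ (fun i => (x i, a i / x i)) ∈ U}

/-- A set of positive pairs which is downward closed among positive pairs. -/
structure IsPosLower {d : ℕ} (U : Set (Fin d → ℝ × ℝ)) : Prop where
  pos : ∀ z ∈ U, ∀ i, 0 < (z i).1 ∧ 0 < (z i).2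
  lower : ∀ z ∈ U, ∀ w : Fin d → ℝ × ℝ, (∀ i, 0 < (w i).1 ∧ 0 < (w i).2) → w ≤ z → w ∈ U

theorem isOpen_mulSet {d : ℕ} {U : Set (Fin d → ℝ × ℝ)} (hU : IsOpen U) : IsOpen (mulSet U) := by
  have : mulSet U = ⋃ (x : Fin d → ℝ) (_ : ∀ i, 0 < x i),
      (fun a : Fin d → ℝ => fun i => (x i, a i / x i)) ⁻¹' U := by
    ext a
    simp [mulSet]
  rw [this]
  exact isOpen_iUnion fun x => isOpen_iUnion fun _ => hU.preimage (by fun_prop)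

/-- If `(x, s / x) ∈ V`, then `V` contains the rectangle `(0, x] × (0, s / x]` of area `s`, so `s ≤
volume V`. -/
theorem volume_products_le (V : Set (ℝ × ℝ)) (hpos : ∀ p ∈ V, 0 < p.1 ∧ 0 < p.2)
    (hlow : ∀ p ∈ V, ∀ q : ℝ × ℝ, 0 < q.1 → 0 < q.2 → q ≤ p → q ∈ V) :
    volume {s : ℝ | ∃ x, 0 < x ∧ (x, s / x) ∈ V} ≤ volume V := by
  by_cases hfin : volume V = ∞
  · rw [hfin]
    exact le_top
  have hsub : {s : ℝ | ∃ x, 0 < x ∧ (x, s / x) ∈ V} ⊆ Set.Ioc 0 (volume V).toReal := by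
    rintro s ⟨x, hx, hxV⟩
    have hp := (hpos _ hxV).2
    have hs : 0 < s := by
      have := mul_pos hp hx
      rwa [div_mul_cancel₀ _ hx.ne'] at this
    refine ⟨hs, ?_⟩
    have hbox : Set.Ioc 0 x ×ˢ Set.Ioc 0 (s / x) ⊆ V := by
      rintro ⟨a, b⟩ ⟨ha, hb⟩
      exact hlow _ hxV _ ha.1 hb.1 ⟨ha.2, hb.2⟩
    have h1 := measure_mono (μ := volume) hbox
    rw [Measure.volume_eq_prod, Measure.prod_prod, Real.volume_Ioc, Real.volume_Ioc, sub_zero,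
      sub_zero, ← ENNReal.ofReal_mul hx.le, mul_div_cancel₀ _ hx.ne',
      ← Measure.volume_eq_prod] at h1
    exact (ENNReal.ofReal_le_iff_le_toReal hfin).1 h1
  refine (measure_mono hsub).trans ?_
  rw [Real.volume_Ioc, sub_zero, ENNReal.ofReal_toReal hfin]

/-- The set of coordinatewise products of an open positive lower set of pairs has at most the
volume of the set of pairs. -/
theorem volume_mulSet_le {d : ℕ} (U : Set (Fin d → ℝ × ℝ)) (hU : IsOpen U) (hL : IsPosLower U) :
    volume (mulSet U) ≤ volume U := by
  induction d with
  | zero =>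
    rcases U.eq_empty_or_nonempty with h | ⟨z, hz⟩
    · simp [mulSet, h]
    · have : U = Set.univ := Set.eq_univ_of_forall fun w => Subsingleton.elim z w ▸ hz
      rw [this, volume_pi, volume_pi, Measure.pi_univ]
      refine (measure_mono (Set.subset_univ _)).trans ?_
      rw [Measure.pi_univ]
      simp
  | succ n ih =>
    have hcons : ∀ x : ℝ, Continuous fun q : ℝ × (Fin n → ℝ × ℝ) =>
        (Fin.cons (x, q.1 / x) q.2 : Fin (n + 1) → ℝ × ℝ) := by
      intro x
      refine continuous_pi fun i => ?_
      refine Fin.cases ?_ (fun j => ?_) i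
      · simp only [Fin.cons_zero]
        fun_prop
      · simp only [Fin.cons_succ]
        fun_prop
    set V : Set ((ℝ × ℝ) × (Fin n → ℝ × ℝ)) :=
      {p | (Fin.cons p.1 p.2 : Fin (n + 1) → ℝ × ℝ) ∈ U} with hV
    -- Intermediate set: only the first pair is replaced by its product. Slicing at a fixed product
    -- uses induction to compare `N` with `U'`; slicing at fixed remaining pairs uses dimension one
    -- to compare `U'` with `V`.
    set U' : Set (ℝ × (Fin n → ℝ × ℝ)) :=
      {q | ∃ x, 0 < x ∧ (Fin.cons (x, q.1 / x) q.2 : Fin (n + 1) → ℝ × ℝ) ∈ U} with hU'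
    set N : Set (ℝ × (Fin n → ℝ)) := {q | (Fin.cons q.1 q.2 : Fin (n + 1) → ℝ) ∈ mulSet U} with hN
    have hVo : IsOpen V := by
      refine hU.preimage (continuous_pi fun i => ?_)
      refine Fin.cases ?_ (fun j => ?_) i
      · simp only [Fin.cons_zero]
        fun_prop
      · simp only [Fin.cons_succ]
        fun_prop
    have hNo : IsOpen N := by
      refine (isOpen_mulSet hU).preimage (continuous_pi fun i => ?_)
      refine Fin.cases ?_ (fun j => ?_) i
      · simp only [Fin.cons_zero]
        fun_prop
      · simp only [Fin.cons_succ]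
        fun_prop
    have hUo : IsOpen U' := by
      have : U' = ⋃ (x : ℝ) (_ : 0 < x), (fun q : ℝ × (Fin n → ℝ × ℝ) =>
          (Fin.cons (x, q.1 / x) q.2 : Fin (n + 1) → ℝ × ℝ)) ⁻¹' U := by
        ext q
        simp [hU']
      rw [this]
      exact isOpen_iUnion fun x => isOpen_iUnion fun _ => hU.preimage (hcons x)
    have hvolU : volume U = volume V := by
      rw [← (volume_preserving_piFinSuccAbove (fun _ : Fin (n + 1) => ℝ × ℝ) 0).symm.measure_preimage
        hU.measurableSet.nullMeasurableSet]
      congr 1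
      ext p
      simp [hV, MeasurableEquiv.piFinSuccAbove, Fin.consEquiv]
    have hvolN : volume (mulSet U) = volume N := by
      rw [← (volume_preserving_piFinSuccAbove (fun _ : Fin (n + 1) => ℝ) 0).symm.measure_preimage
        (isOpen_mulSet hU).measurableSet.nullMeasurableSet]
      congr 1
      ext p
      simp [hN, MeasurableEquiv.piFinSuccAbove, Fin.consEquiv]
    have hslice1 : ∀ s : ℝ, volume (Prod.mk s ⁻¹' N) ≤ volume (Prod.mk s ⁻¹' U') := by
      intro s
      have heq : Prod.mk s ⁻¹' N = mulSet (Prod.mk s ⁻¹' U') := by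
        ext a
        simp only [hN, hU', mulSet, Set.mem_preimage, Set.mem_ofPred_eq]
        constructor
        · rintro ⟨x, hx, hxU⟩
          refine ⟨Fin.tail x, fun i => hx _, x 0, hx 0, ?_⟩
          convert hxU using 1
          funext i
          refine Fin.cases ?_ (fun j => ?_) i <;> simp [Fin.tail]
        · rintro ⟨x', hx', x, hx, hxU⟩
          refine ⟨Fin.cons x x', fun i => Fin.cases hx hx' i, ?_⟩
          convert hxU using 1
          funext i
          refine Fin.cases ?_ (fun j => ?_) i <;> simp
      rw [heq]
      refine ih _ (hUo.preimage (by fun_prop)) ⟨?_, ?_⟩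
      · rintro z ⟨x, hx, hxU⟩ i
        have := hL.pos _ hxU i.succ
        simpa using this
      · rintro z ⟨x, hx, hxU⟩ w hw hwz
        refine ⟨x, hx, hL.lower _ hxU _ (fun i => ?_) (fun i => ?_)⟩
        · refine Fin.cases ?_ (fun j => ?_) i
          · exact hL.pos _ hxU 0
          · simpa using hw j
        · refine Fin.cases ?_ (fun j => ?_) i
          · exact le_rfl
          · simpa using hwz j
    have hslice2 : ∀ z : Fin n → ℝ × ℝ,
        volume ((fun s => (s, z)) ⁻¹' U') ≤ volume ((fun p => (p, z)) ⁻¹' V) := by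
      intro z
      refine volume_products_le _ (fun p hp => hL.pos _ hp 0) ?_
      intro p hp q hq1 hq2 hqp
      refine hL.lower _ hp _ (fun i => ?_) (fun i => ?_)
      · refine Fin.cases ?_ (fun j => ?_) i
        · exact ⟨hq1, hq2⟩
        · simpa using hL.pos _ hp j.succ
      · refine Fin.cases ?_ (fun j => ?_) i
        · exact hqp
        · exact le_rfl
    rw [hvolU, hvolN]
    calc volume N = ∫⁻ s, volume (Prod.mk s ⁻¹' N) := by
          rw [Measure.volume_eq_prod, Measure.prod_apply hNo.measurableSet]
      _ ≤ ∫⁻ s, volume (Prod.mk s ⁻¹' U') := lintegral_mono hslice1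
      _ = volume U' := by
          rw [Measure.volume_eq_prod, Measure.prod_apply hUo.measurableSet]
      _ = ∫⁻ z, volume ((fun s => (s, z)) ⁻¹' U') := by
          rw [Measure.volume_eq_prod, Measure.prod_apply_symm hUo.measurableSet]
      _ ≤ ∫⁻ z, volume ((fun p => (p, z)) ⁻¹' V) := lintegral_mono hslice2
      _ = volume V := (Measure.prod_apply_symm hVo.measurableSet).symm

/-! ### Factorization by minimizing with a logarithmic barrier -/

/-- This is `log u ≤ u - 1` at `u = αx / (2a)`: half of the linear growth `αx` absorbs the
logarithm, leaving the other half for coercivity. -/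
theorem mul_log_le {α a x : ℝ} (hα : 0 < α) (ha : 0 < a) (hx : 0 < x) :
    a * Real.log x ≤ α * x / 2 - (a + a * Real.log (α / (2 * a))) := by
  have h := Real.log_le_sub_one_of_pos (show 0 < α / (2 * a) * x by positivity)
  rw [Real.log_mul (by positivity) hx.ne'] at h
  have h2 := mul_le_mul_of_nonneg_left h ha.le
  have h3 : a * (α / (2 * a) * x - 1) = α * x / 2 - a := by
    field_simp
  linarith

/-- Along a segment issued from a minimizer of `r - ∑ aᵢ log xᵢ` over the epigraph. -/
theorem sum_mul_sub_div_le {g : EuclideanSpace ℝ (Fin d) → EReal} (hconv : IsConvexFun g)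
    {a : Fin d → ℝ} {x : EuclideanSpace ℝ (Fin d)} {r : ℝ}
    (hx : ∀ i, 0 < x i) (hr : g x ≤ r)
    (hmin : ∀ (z : EuclideanSpace ℝ (Fin d)) (s : ℝ), (∀ i, 0 < z i) → g z ≤ s →
      r - ∑ i, a i * Real.log (x i) ≤ s - ∑ i, a i * Real.log (z i))
    {z : EuclideanSpace ℝ (Fin d)} {s : ℝ} (hz : g z ≤ s) :
    ∑ i, a i * ((z i - x i) / x i) ≤ s - r := by
  -- The objective along the segment in the epigraph from `(x, r)` to `(z, s)`. Coordinates stay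
  -- positive for small `t`, so the right derivative at the minimizer is nonnegative.
  set θ : ℝ → ℝ := fun t => r + t * (s - r) - ∑ i, a i * Real.log (x i + t * (z i - x i)) with hθ
  have hd : HasDerivAt θ ((s - r) - ∑ i, a i * ((z i - x i) / x i)) 0 := by
    refine HasDerivAt.sub ?_ (HasDerivAt.fun_sum fun i _ => ?_)
    · simpa using ((hasDerivAt_id (0 : ℝ)).mul_const (s - r)).const_add r
    · refine HasDerivAt.const_mul _ ?_
      have h1 : HasDerivAt (fun t : ℝ => x i + t * (z i - x i)) (z i - x i) 0 := by
        simpa using ((hasDerivAt_id (0 : ℝ)).mul_const (z i - x i)).const_add (x i)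
      have h2 := h1.log (by simpa using (hx i).ne')
      simpa using h2
  have hev : ∀ᶠ t in nhdsWithin (0 : ℝ) (Set.Ioi 0), 0 ≤ t⁻¹ • (θ (0 + t) - θ 0) := by
    have hpos : ∀ᶠ t in nhdsWithin (0 : ℝ) (Set.Ioi 0), ∀ i, 0 < x i + t * (z i - x i) := by
      rw [Filter.eventually_all]
      intro i
      refine nhdsWithin_le_nhds ?_
      have hc : Continuous fun t : ℝ => x i + t * (z i - x i) := by fun_prop
      exact hc.continuousAt.eventually (lt_mem_nhds (by simpa using hx i))
    have hle : ∀ᶠ t in nhdsWithin (0 : ℝ) (Set.Ioi 0), t < 1 :=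
      nhdsWithin_le_nhds (gt_mem_nhds one_pos)
    filter_upwards [hpos, hle, self_mem_nhdsWithin] with t ht ht1 ht0
    have ht0' : (0 : ℝ) < t := ht0
    refine smul_nonneg (inv_nonneg.2 ht0'.le) (sub_nonneg.2 ?_)
    have hmem := hconv (x := (x, r)) hr (y := (z, s)) hz (a := 1 - t) (b := t) (by linarith)
      ht0'.le (by ring)
    simp only [Set.mem_ofPred_eq, Prod.smul_mk, Prod.mk_add_mk, smul_eq_mul] at hmem
    have hco : ∀ i, ((1 - t) • x + t • z) i = x i + t * (z i - x i) := by
      intro i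
      simp only [PiLp.add_apply, PiLp.smul_apply, smul_eq_mul]
      ring
    have h := hmin _ _ (fun i => by rw [hco]; exact ht i) hmem
    simp only [hco] at h
    simp only [hθ, zero_add, zero_mul, add_zero]
    linarith
  have := ge_of_tendsto hd.tendsto_slope_zero_right hev
  linarith

/-- Linear growth beats the logarithms at infinity and the logarithms repel from the hyperplanes, so
a sublevel set lies in a compact set on which the objective is continuous. -/
theorem exists_isMinOn_sub_sum_log {g : EuclideanSpace ℝ (Fin d) → EReal}
    (hclosed : IsClosed {p : EuclideanSpace ℝ (Fin d) × ℝ | g p.1 ≤ (p.2 : EReal)})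
    {α c : ℝ} (hα : 0 < α)
    (hgrow : ∀ (x : EuclideanSpace ℝ (Fin d)) (r : ℝ), g x ≤ r → α * ∑ i, |x i| - c ≤ r)
    {x₀ : EuclideanSpace ℝ (Fin d)} (hx₀ : ∀ i, 0 < x₀ i) {r₀ : ℝ} (hr₀ : g x₀ ≤ r₀)
    {a : Fin d → ℝ} (ha : ∀ i, 0 < a i) :
    ∃ (x : EuclideanSpace ℝ (Fin d)) (r : ℝ), (∀ i, 0 < x i) ∧ g x ≤ r ∧
      ∀ (z : EuclideanSpace ℝ (Fin d)) (s : ℝ), (∀ i, 0 < z i) → g z ≤ s →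
      r - ∑ i, a i * Real.log (x i) ≤ s - ∑ i, a i * Real.log (z i) := by
  set W : EuclideanSpace ℝ (Fin d) × ℝ → ℝ := fun p => p.2 - ∑ i, a i * Real.log (p.1 i) with hW
  set V := W (x₀, r₀) with hV
  set m : Fin d → ℝ := fun i => a i + a i * Real.log (α / (2 * a i)) with hm
  -- On the sublevel set of `V`, `T` bounds each `α xᵢ - aᵢ log xᵢ`, hence `xᵢ ≥ exp (-T / aᵢ)`;
  -- with `mul_log_le` it also gives `xᵢ ≤ R`, and then `r ≤ M`.
  set T := V + c + ∑ i, |m i| with hT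
  set R := 2 * (T + ∑ i, |m i|) / α with hR
  set M := V + ∑ i, (α * R / 2 + |m i|) with hM
  have hlog : ∀ i {x : ℝ}, 0 < x → a i * Real.log x ≤ α * x / 2 - m i := fun i x hx =>
    mul_log_le hα (ha i) hx
  have hbound : ∀ (x : EuclideanSpace ℝ (Fin d)) (r : ℝ), (∀ i, 0 < x i) → g x ≤ r →
      W (x, r) ≤ V → (∀ i, x i ∈ Set.Icc (Real.exp (-T / a i)) R) ∧ r ∈ Set.Icc (-c) M := by
    intro x r hx hr hle
    have h1 : α * ∑ i, x i - c ≤ r := by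
      have := hgrow x r hr
      rwa [Finset.sum_congr rfl fun i _ => abs_of_pos (hx i)] at this
    have h2 : r - ∑ i, a i * Real.log (x i) ≤ V := hle
    have h3 : ∀ i, α * x i - a i * Real.log (x i) ≤ T := by
      intro i
      -- Adding `|m j|` makes every summand nonnegative, so a single one is at most the sum.
      have h4 : α * x i - a i * Real.log (x i) + |m i| ≤
          ∑ j, (α * x j - a j * Real.log (x j) + |m j|) := by
        refine Finset.single_le_sum
          (f := fun j => α * x j - a j * Real.log (x j) + |m j|) (fun j _ => ?_)
          (Finset.mem_univ i)
        have := hlog j (hx j)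
        have := neg_abs_le (m j)
        have := mul_pos hα (hx j)
        linarith
      rw [Finset.sum_add_distrib, Finset.sum_sub_distrib, ← Finset.mul_sum] at h4
      have := abs_nonneg (m i)
      linarith
    have hmi : ∀ i, |m i| ≤ ∑ j, |m j| := fun i =>
      Finset.single_le_sum (f := fun j => |m j|) (fun j _ => abs_nonneg _) (Finset.mem_univ i)
    have hxR : ∀ i, x i ≤ R := by
      intro i
      rw [hR, le_div_iff₀ hα]
      have := hlog i (hx i)
      have := h3 i
      have := neg_abs_le (m i)
      have := hmi i
      linarith
    refine ⟨fun i => ⟨?_, hxR i⟩, ?_, ?_⟩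
    · rw [← Real.le_log_iff_exp_le (hx i), div_le_iff₀ (ha i)]
      have := h3 i
      have := mul_pos hα (hx i)
      linarith
    · have : 0 ≤ α * ∑ i, x i := mul_nonneg hα.le (Finset.sum_nonneg fun i _ => (hx i).le)
      linarith
    · have : ∑ i, a i * Real.log (x i) ≤ ∑ i, (α * R / 2 + |m i|) := by
        refine Finset.sum_le_sum fun i _ => ?_
        have := hlog i (hx i)
        have := neg_abs_le (m i)
        have := mul_le_mul_of_nonneg_left (hxR i) hα.le
        linarith
      linarith
  set K : Set (EuclideanSpace ℝ (Fin d) × ℝ) :=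
    ((WithLp.toLp 2 '' Set.univ.pi fun i => Set.Icc (Real.exp (-T / a i)) R) ×ˢ Set.Icc (-c) M) ∩
      {p | g p.1 ≤ (p.2 : EReal)} with hK
  have hKc : IsCompact K :=
    (((isCompact_univ_pi fun i => isCompact_Icc).image (PiLp.continuous_toLp 2 _)).prod
      isCompact_Icc).inter_right hclosed
  have hmemK : ∀ (x : EuclideanSpace ℝ (Fin d)) (r : ℝ), (∀ i, 0 < x i) → g x ≤ r →
      W (x, r) ≤ V → (x, r) ∈ K := by
    intro x r hx hr hle
    obtain ⟨h1, h2⟩ := hbound x r hx hr hle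
    exact ⟨⟨⟨x.ofLp, fun i _ => h1 i, rfl⟩, h2⟩, hr⟩
  have hKpos : ∀ p ∈ K, ∀ i, 0 < p.1 i := by
    rintro ⟨_, r⟩ ⟨⟨⟨x, hx, rfl⟩, -⟩, -⟩ i
    exact (Real.exp_pos _).trans_le (hx i trivial).1
  have hWc : ContinuousOn W K := by
    refine continuousOn_snd.sub (continuousOn_finsetSum _ fun i _ => ?_)
    refine continuousOn_const.mul (ContinuousOn.log ?_ fun p hp => (hKpos p hp i).ne')
    fun_prop
  obtain ⟨⟨x, r⟩, hxK, hmin⟩ := hKc.exists_isMinOn ⟨_, hmemK x₀ r₀ hx₀ hr₀ le_rfl⟩ hWc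
  refine ⟨x, r, hKpos _ hxK, hxK.2, fun z s hz hs => ?_⟩
  rcases le_total (W (z, s)) V with h | h
  · exact hmin (hmemK z s hz hs h)
  · exact le_trans (hmin (hmemK x₀ r₀ hx₀ hr₀ le_rfl)) h

/-- A functional form of Lozanovskii's factorization lemma. -/
theorem exists_factorization {g : EuclideanSpace ℝ (Fin d) → EReal} (hconv : IsConvexFun g)
    (hclosed : IsClosed {p : EuclideanSpace ℝ (Fin d) × ℝ | g p.1 ≤ (p.2 : EReal)})
    {α c : ℝ} (hα : 0 < α)
    (hgrow : ∀ (x : EuclideanSpace ℝ (Fin d)) (r : ℝ), g x ≤ r → α * ∑ i, |x i| - c ≤ r)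
    {x₀ : EuclideanSpace ℝ (Fin d)} (hx₀ : ∀ i, 0 < x₀ i) {r₀ : ℝ} (hr₀ : g x₀ ≤ r₀)
    {a : Fin d → ℝ} (ha : ∀ i, 0 < a i) :
    ∃ (x : EuclideanSpace ℝ (Fin d)) (r : ℝ), (∀ i, 0 < x i) ∧ g x ≤ r ∧
      legendre g (WithLp.toLp 2 fun i => a i / x i) ≤ ((∑ i, a i - r : ℝ) : EReal) := by
  obtain ⟨x, r, hx, hr, hmin⟩ := exists_isMinOn_sub_sum_log hclosed hα hgrow hx₀ hr₀ ha
  refine ⟨x, r, hx, hr, legendre_le_coe_iff.2 fun z s hs => ?_⟩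
  -- The first-order condition says that `a / x` is a subgradient of `g` at `x`, which gives the
  -- bound on `g*` there.
  have h := sum_mul_sub_div_le hconv hx hr hmin hs
  have h1 : ∑ i, a i * ((z i - x i) / x i) = ∑ i, z i * (a i / x i) - ∑ i, a i := by
    rw [← Finset.sum_sub_distrib]
    refine Finset.sum_congr rfl fun i _ => ?_
    have := (hx i).ne'
    field_simp
  have h2 : inner ℝ z (WithLp.toLp 2 fun i => a i / x i) = ∑ i, z i * (a i / x i) := by
    rw [PiLp.inner_apply]
    refine Finset.sum_congr rfl fun i _ => ?_
    simp [mul_comm]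
  rw [h2]
  linarith

/-! ### Unconditional symmetry -/

/-- Exact invariance of a function under all coordinate reflections. -/
def IsSignSymm (g : EuclideanSpace ℝ (Fin d) → EReal) : Prop :=
  ∀ i x, g (coordReflection i x) = g x

theorem coordReflection_apply (i j : Fin d) (x : EuclideanSpace ℝ (Fin d)) :
    coordReflection i x j = if j = i then -x j else x j := by
  unfold coordReflection
  by_cases h : j = i
  · subst h
    simp
  · simp [h]

theorem coordReflection_coordReflection (i : Fin d) (x : EuclideanSpace ℝ (Fin d)) :
    coordReflection i (coordReflection i x) = x := by
  ext j
  rw [coordReflection_apply, coordReflection_apply]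
  split_ifs <;> simp

theorem inner_coordReflection (i : Fin d) (x y : EuclideanSpace ℝ (Fin d)) :
    inner ℝ (coordReflection i x) y = inner ℝ x (coordReflection i y) := by
  rw [PiLp.inner_apply, PiLp.inner_apply]
  refine Finset.sum_congr rfl fun j _ => ?_
  rw [coordReflection_apply, coordReflection_apply]
  split_ifs <;> simp

theorem measurePreserving_coordReflection (i : Fin d) :
    MeasurePreserving (coordReflection i) (volume : Measure (EuclideanSpace ℝ (Fin d))) volume := by
  have : (coordReflection i : EuclideanSpace ℝ (Fin d) → EuclideanSpace ℝ (Fin d)) =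
      LinearIsometryEquiv.piLpCongrRight 2
        (fun j : Fin d => if j = i then LinearIsometryEquiv.neg ℝ else LinearIsometryEquiv.refl ℝ ℝ) := by
    funext x
    ext j
    rw [coordReflection_apply, LinearIsometryEquiv.piLpCongrRight_apply]
    split_ifs <;> simp_all
  rw [this]
  exact LinearIsometryEquiv.measurePreserving _

/-- Equal measures of finite mass have almost everywhere equal densities, and `EReal.exp` is
injective. -/
theorem ae_eq_comp_coordReflection {g : EuclideanSpace ℝ (Fin d) → EReal} (hg : Measurable g)
    (hpos : expMass g ≠ 0) (hfin : expMass g ≠ ∞) (hunc : IsUnconditional (expMeasure g))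
    (i : Fin d) : (fun x => g (coordReflection i x)) =ᵐ[volume] g := by
  set F : EuclideanSpace ℝ (Fin d) → ℝ≥0∞ := fun x => EReal.exp (-g x) with hF
  have hFm : Measurable F := by
    exact EReal.measurable_exp.comp hg.neg
  have hσ := measurePreserving_coordReflection i
  have hmap : (volume.withDensity F).map (coordReflection i) =
      volume.withDensity fun x => F (coordReflection i x) := by
    ext s hs
    rw [Measure.map_apply hσ.measurable hs, withDensity_apply _ (hσ.measurable hs),
      withDensity_apply _ hs]
    have h := hσ.setLIntegral_comp_preimage hs (f := fun x => F (coordReflection i x))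
      (hFm.comp hσ.measurable)
    simpa only [coordReflection_coordReflection] using h
  have h := hunc i
  unfold expMeasure at h
  rw [Measure.map_smul, hmap] at h
  have h2 := congrArg (fun ν => expMass g • ν) h
  simp only [smul_smul, ENNReal.mul_inv_cancel hpos hfin, one_smul] at h2
  have h3 := (withDensity_eq_iff (f := fun x => F (coordReflection i x)) (g := F)
    (hFm.comp hσ.measurable).aemeasurable hFm.aemeasurable ?_).1 h2
  · filter_upwards [h3] with x hx
    have := EReal.exp_strictMono.injective hx
    exact neg_injective this
  · rw [hσ.lintegral_comp hFm]
    exact hfin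

/-- The transform is an essential supremum, so the null set where `f` fails to be symmetric is
invisible to it. -/
theorem isSignSymm_legendre_of_ae {f : EuclideanSpace ℝ (Fin d) → EReal} (hf : IsConvexFun f)
    (hpos : expMass f ≠ 0)
    (hae : ∀ i, (fun x => f (coordReflection i x)) =ᵐ[volume] f) : IsSignSymm (legendre f) := by
  have key : ∀ i y, legendre f (coordReflection i y) ≤ legendre f y := by
    intro i y
    refine ereal_le_of_forall_coe fun c hc => legendre_le_of_ae hf hpos ?_
    filter_upwards [hae i] with x hx r hr
    rw [← inner_coordReflection]
    exact legendre_le_coe_iff.1 hc _ r (hx.trans_le hr)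
  intro i y
  refine le_antisymm (key i y) ?_
  conv_lhs => rw [← coordReflection_coordReflection i y]
  exact key i _

theorem IsSignSymm.legendre {h : EuclideanSpace ℝ (Fin d) → EReal} (hs : IsSignSymm h) :
    IsSignSymm (legendre h) := by
  have key : ∀ i y, ReverseTalagrand.legendre h (coordReflection i y) ≤
      ReverseTalagrand.legendre h y := by
    intro i y
    refine ereal_le_of_forall_coe fun c hc => legendre_le_coe_iff.2 fun x r hr => ?_
    rw [← inner_coordReflection]
    exact legendre_le_coe_iff.1 hc _ r ((hs i x).trans_le hr)
  intro i y
  refine le_antisymm (key i y) ?_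
  conv_lhs => rw [← coordReflection_coordReflection i y]
  exact key i _

theorem IsSignSymm.eq_of_abs_eq {g : EuclideanSpace ℝ (Fin d) → EReal} (hs : IsSignSymm g)
    {x x' : EuclideanSpace ℝ (Fin d)} (h : ∀ i, |x i| = |x' i|) : g x = g x' := by
  classical
  have key : ∀ s : Finset (Fin d),
      g (WithLp.toLp 2 fun i => if i ∈ s then x i else x' i) = g x' := by
    intro s
    induction s using Finset.induction_on with
    | empty => simp
    | insert j s hj ih =>
      rw [← ih]
      rcases abs_eq_abs.1 (h j) with hx | hx
      · congr 1
        ext i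
        by_cases hij : i = j
        · subst hij
          simp [hj, hx]
        · simp [hij]
      · rw [← hs j (WithLp.toLp 2 fun i => if i ∈ s then x i else x' i)]
        congr 1
        ext i
        rw [coordReflection_apply]
        by_cases hij : i = j
        · subst hij
          simp [hj, hx]
        · simp [hij]
  simpa using (key Finset.univ)

/-- The vector with the absolute values of the coordinates of `y` and the signs of `x`. -/
noncomputable def withSigns (x y : EuclideanSpace ℝ (Fin d)) : EuclideanSpace ℝ (Fin d) :=
  WithLp.toLp 2 fun i => if 0 ≤ x i then |y i| else -|y i|

theorem abs_withSigns (x y : EuclideanSpace ℝ (Fin d)) (i : Fin d) :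
    |withSigns x y i| = |y i| := by
  simp only [withSigns]
  split_ifs <;> simp

theorem inner_withSigns (x y : EuclideanSpace ℝ (Fin d)) :
    inner ℝ (withSigns x y) x = ∑ i, |x i| * |y i| := by
  rw [PiLp.inner_apply]
  refine Finset.sum_congr rfl fun i _ => ?_
  simp only [withSigns]
  split_ifs with h
  · simp [abs_of_nonneg h]
  · simp [abs_of_neg (not_le.1 h)]

/-- Giving `y` the signs of `x'` turns `⟨y, x'⟩` into `∑ |x'ᵢ| |yᵢ|`, which dominates `⟨y, x⟩`. This
monotonicity later makes superlevel sets lower sets. -/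
theorem IsSignSymm.legendre_mono {h : EuclideanSpace ℝ (Fin d) → EReal} (hs : IsSignSymm h)
    {x x' : EuclideanSpace ℝ (Fin d)} (hle : ∀ i, |x i| ≤ |x' i|) :
    ReverseTalagrand.legendre h x ≤ ReverseTalagrand.legendre h x' := by
  refine ereal_le_of_forall_coe fun c hc => legendre_le_coe_iff.2 fun y r hr => ?_
  have h1 := legendre_le_coe_iff.1 hc (withSigns x' y) r
    ((hs.eq_of_abs_eq (abs_withSigns x' y)).trans_le hr)
  rw [inner_withSigns] at h1
  have h2 : inner ℝ y x ≤ ∑ i, |x' i| * |y i| := by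
    rw [PiLp.inner_apply]
    refine Finset.sum_le_sum fun i _ => ?_
    refine (le_abs_self _).trans ?_
    simp only [RCLike.inner_apply, conj_trivial, abs_mul]
    exact mul_le_mul_of_nonneg_right (hle i) (abs_nonneg _)
  linarith

/-- If `h` is finite at a point off the coordinate hyperplanes then its Legendre transform
grows at least linearly. -/
theorem IsSignSymm.exists_growth {h : EuclideanSpace ℝ (Fin d) → EReal} (hs : IsSignSymm h)
    {y₀ : EuclideanSpace ℝ (Fin d)} (hy₀ : ∀ i, 0 < y₀ i) {s : ℝ} (hys : h y₀ ≤ s) :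
    ∃ α > 0, ∀ (x : EuclideanSpace ℝ (Fin d)) (r : ℝ),
      ReverseTalagrand.legendre h x ≤ r → α * ∑ i, |x i| - s ≤ r := by
  obtain ⟨α, hα, hle⟩ : ∃ α > 0, ∀ i, α ≤ y₀ i := by
    rcases isEmpty_or_nonempty (Fin d) with he | hne
    · exact ⟨1, one_pos, fun i => he.elim i⟩
    · obtain ⟨j, hj⟩ := Finite.exists_min y₀.ofLp
      exact ⟨y₀ j, hy₀ j, hj⟩
  refine ⟨α, hα, fun x r hr => ?_⟩
  have h1 := legendre_le_coe_iff.1 hr (withSigns x y₀) s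
    ((hs.eq_of_abs_eq (abs_withSigns x y₀)).trans_le hys)
  rw [inner_withSigns] at h1
  have h2 : α * ∑ i, |x i| ≤ ∑ i, |x i| * |y₀ i| := by
    rw [Finset.mul_sum]
    refine Finset.sum_le_sum fun i _ => ?_
    rw [mul_comm]
    exact mul_le_mul_of_nonneg_left ((hle i).trans (le_abs_self _)) (abs_nonneg _)
  linarith

/-! ### Finite points in the positive orthant -/

theorem expMass_eq_lintegral_pi (g : EuclideanSpace ℝ (Fin d) → EReal) :
    expMass g = ∫⁻ x : Fin d → ℝ, EReal.exp (-g (WithLp.toLp 2 x)) := by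
  unfold expMass
  exact ((PiLp.volume_preserving_toLp (Fin d)).lintegral_comp_emb
    (MeasurableEquiv.toLp 2 (Fin d → ℝ)).measurableEmbedding _).symm

/-- A function not depending on one of the coordinates has mass `0` or `∞`. -/
theorem expMass_eq_zero_or_top {g : EuclideanSpace ℝ (Fin d) → EReal} (hg : Measurable g)
    (i : Fin d) (hi : ∀ x x' : EuclideanSpace ℝ (Fin d), (∀ j, j ≠ i → x j = x' j) → g x = g x') :
    expMass g = 0 ∨ expMass g = ∞ := by
  classical
  rw [expMass_eq_lintegral_pi]
  set F : (Fin d → ℝ) → ℝ≥0∞ := fun x => EReal.exp (-g (WithLp.toLp 2 x)) with hF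
  have hFm : Measurable F :=
    EReal.measurable_exp.comp (hg.comp (MeasurableEquiv.toLp 2 (Fin d → ℝ)).measurable).neg
  -- Stretching the `i`-th coordinate by 2 preserves `F` but scales volume, so its integral `I`
  -- satisfies `I = 2I`.
  set D : Fin d → ℝ := Function.update 1 i 2 with hD
  have hdet : (Matrix.diagonal D).det = 2 := by
    rw [Matrix.det_diagonal, hD, Finset.prod_update_of_mem (Finset.mem_univ i)]
    simp
  have hvol := Real.smul_map_diagonal_volume_pi (D := D) (by rw [hdet]; norm_num)
  have hTm : Measurable (Matrix.toLin' (Matrix.diagonal D)) :=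
    (LinearMap.continuous_on_pi _).measurable
  have h1 : ∫⁻ x, F x = 2 * ∫⁻ x, F x := by
    conv_lhs => rw [← hvol, lintegral_smul_measure, lintegral_map hFm hTm]
    rw [hdet]
    simp only [abs_two, ENNReal.ofReal_ofNat, smul_eq_mul]
    congr 2
    funext x
    simp only [hF]
    congr 2
    refine hi _ _ fun j hj => ?_
    simp [Matrix.mulVec_diagonal, hD, hj]
  by_contra! hcon
  have h2 : (1 : ℝ≥0∞) * ∫⁻ x, F x = 2 * ∫⁻ x, F x := by rw [one_mul]; exact h1
  rw [ENNReal.mul_left_inj hcon.1 hcon.2] at h2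
  norm_num at h2

/-- If the domain of `h` lay in `{yᵢ = 0}`, `g` would not depend on `xᵢ` and have mass `0` or `∞`.
So each `i` has a domain point with `yᵢ ≠ 0`; the average of their absolute values is in the convex
symmetric domain and has positive coordinates. -/
theorem exists_pos_legendre_lt_top {g h : EuclideanSpace ℝ (Fin d) → EReal}
    (hgh : g = legendre h) (hconv : IsConvexFun h) (hs : IsSignSymm h)
    (hpos : expMass g ≠ 0) (hfin : expMass g ≠ ∞) :
    ∃ y : EuclideanSpace ℝ (Fin d), (∀ i, 0 < y i) ∧ h y < ⊤ := by
  classical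
  have hBc : Convex ℝ {y | h y < ⊤} := convex_domain hconv
  have hne : ∃ y, h y < ⊤ := by
    by_contra! hcon
    have hg : ∀ x, g x = ⊥ := by
      intro x
      rw [EReal.eq_bot_iff_forall_lt]
      intro r
      have : g x ≤ ((r - 1 : ℝ) : EReal) := by
        rw [hgh]
        refine legendre_le_coe_iff.2 fun y s hy => ?_
        exact absurd (hy.trans_lt (EReal.coe_lt_top s)) (not_lt.2 (hcon y))
      refine this.trans_lt ?_
      exact_mod_cast sub_one_lt r
    apply hfin
    simp only [expMass, hg, EReal.neg_bot, EReal.exp_top, lintegral_const]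
    exact ENNReal.top_mul (isOpen_univ.measure_ne_zero volume Set.univ_nonempty)
  have hcoord : ∀ i : Fin d, ∃ y, h y < ⊤ ∧ y i ≠ 0 := by
    intro i
    by_contra! hcon
    have hgi : ∀ x x' : EuclideanSpace ℝ (Fin d), (∀ j, j ≠ i → x j = x' j) → g x ≤ g x' := by
      intro x x' hxx
      rw [hgh]
      refine ereal_le_of_forall_coe fun c hc => legendre_le_coe_iff.2 fun y r hr => ?_
      have h1 := legendre_le_coe_iff.1 hc y r hr
      have h2 : inner ℝ y x = inner ℝ y x' := by
        rw [PiLp.inner_apply, PiLp.inner_apply]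
        refine Finset.sum_congr rfl fun j _ => ?_
        by_cases hj : j = i
        · subst hj
          simp [hcon y (hr.trans_lt (EReal.coe_lt_top r))]
        · rw [hxx j hj]
      rw [h2]
      exact h1
    have hgm : Measurable g := hgh ▸ measurable_legendre
    rcases expMass_eq_zero_or_top hgm i fun x x' hxx =>
      le_antisymm (hgi x x' hxx) (hgi x' x fun j hj => (hxx j hj).symm) with h0 | h0
    · exact hpos h0
    · exact hfin h0
  -- The average below divides by `d`, so dimension zero is separate.
  rcases Nat.eq_zero_or_pos d with rfl | hd
  · obtain ⟨y, hy⟩ := hne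
    exact ⟨y, fun i => i.elim0, hy⟩
  choose y hy hyi using hcoord
  set z : Fin d → EuclideanSpace ℝ (Fin d) := fun j => WithLp.toLp 2 fun i => |y j i| with hz
  have hzB : ∀ j, z j ∈ {y | h y < ⊤} := by
    intro j
    have : h (z j) = h (y j) := hs.eq_of_abs_eq fun i => by simp [hz]
    exact this.trans_lt (hy j)
  have hd' : (0 : ℝ) < d := Nat.cast_pos.2 hd
  have hmem := hBc.sum_mem (t := Finset.univ) (w := fun _ : Fin d => (d : ℝ)⁻¹) (z := z)
    (fun _ _ => (inv_pos.2 hd').le) (by simp [hd'.ne']) (fun j _ => hzB j)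
  refine ⟨_, fun i => ?_, hmem⟩
  rw [WithLp.ofLp_sum, Finset.sum_apply]
  refine Finset.sum_pos' (fun j _ => ?_) ⟨i, Finset.mem_univ i, ?_⟩
  · simp only [PiLp.smul_apply, smul_eq_mul, hz]
    positivity
  · have := abs_pos.2 (hyi i)
    simp only [PiLp.smul_apply, smul_eq_mul, hz]
    positivity

theorem exists_pos_lt_top {g : EuclideanSpace ℝ (Fin d) → EReal} (hs : IsSignSymm g)
    (hpos : expMass g ≠ 0) : ∃ x : EuclideanSpace ℝ (Fin d), (∀ i, 0 < x i) ∧ g x < ⊤ := by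
  by_contra! hcon
  apply hpos
  rw [expMass_eq_lintegral_pi]
  have h1 : ∀ᵐ x : Fin d → ℝ, ∀ i, x i ≠ 0 := by
    rw [ae_all_iff]
    intro i
    exact Measure.ae_eval_ne (μ := fun _ => volume) i 0
  have h2 : (fun x : Fin d → ℝ => EReal.exp (-g (WithLp.toLp 2 x))) =ᵐ[volume] fun _ => 0 := by
    filter_upwards [h1] with x hx
    rw [EReal.exp_eq_zero_iff, EReal.neg_eq_bot_iff, ← top_le_iff]
    refine (hcon (WithLp.toLp 2 fun i => |x i|) fun i => by simpa using hx i).trans_eq ?_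
    exact hs.eq_of_abs_eq fun i => by simp
  rw [lintegral_congr_ae h2]
  simp

/-! ### Integrals over the positive orthant -/

theorem lintegral_pi_prod {n : ℕ} (μ : Fin n → Measure ℝ) [∀ i, SigmaFinite (μ i)]
    {f : Fin n → ℝ → ℝ≥0∞} (hf : ∀ i, Measurable (f i)) :
    ∫⁻ x, ∏ i, f i (x i) ∂Measure.pi μ = ∏ i, ∫⁻ x, f i x ∂μ i := by
  induction n with
  | zero => simp
  | succ n ih =>
    rw [← (measurePreserving_piFinSuccAbove μ 0).symm.lintegral_comp_emb
      (MeasurableEquiv.measurableEmbedding _), Fin.prod_univ_succ]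
    have h := lintegral_prod_mul (μ := μ 0) (ν := Measure.pi fun j : Fin n => μ j.succ)
      (f := f 0) (g := fun y => ∏ j : Fin n, f j.succ (y j)) (hf 0).aemeasurable
      (Finset.measurable_prod _ fun j _ => (hf j.succ).comp (measurable_pi_apply j)).aemeasurable
    rw [ih (fun j => μ j.succ) (fun j => hf j.succ)] at h
    rw [← h]
    refine lintegral_congr fun p => ?_
    rw [Fin.prod_univ_succ]
    simp [MeasurableEquiv.piFinSuccAbove, Fin.consEquiv]

theorem map_abs_volume : (volume : Measure ℝ).map (fun x => |x|) =
    volume.restrict (Set.Ioi 0) + volume.restrict (Set.Ioi 0) := by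
  ext s hs
  have hA : MeasurableSet ((fun x : ℝ => |x|) ⁻¹' s) := measurable_abs hs
  rw [Measure.map_apply measurable_abs hs, Measure.add_apply, Measure.restrict_apply hs,
    ← measure_inter_add_sdiff _ (measurableSet_Ioi (a := (0 : ℝ)))]
  congr 1
  · congr 1
    ext x
    simp only [Set.mem_inter_iff, Set.mem_preimage, Set.mem_Ioi, and_congr_left_iff]
    intro hx
    rw [abs_of_pos hx]
  · rw [← Measure.measure_preimage_neg]
    refine measure_congr ?_
    have h0 : ∀ᵐ x : ℝ, x ≠ 0 := by simp [ae_iff]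
    filter_upwards [h0] with x hx
    refine propext ?_
    change (|-x| ∈ s ∧ ¬ 0 < -x) ↔ (x ∈ s ∧ 0 < x)
    rcases lt_or_gt_of_ne hx with h | h
    · simp [h, h.le]
    · simp [abs_of_pos h, h, h.le]

/-- Taking absolute values folds Lebesgue measure onto the orthant with multiplicity `2 ^ d`. -/
theorem lintegral_eq_two_pow_mul {F : (Fin d → ℝ) → ℝ≥0∞} (hF : Measurable F)
    (hs : ∀ x, F (fun i => |x i|) = F x) :
    ∫⁻ x, F x = 2 ^ d * ∫⁻ x in Set.univ.pi fun _ => Set.Ioi 0, F x := by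
  have hmap : (volume : Measure (Fin d → ℝ)).map (fun x i => |x i|) =
      (2 : ℝ≥0∞) ^ d • volume.restrict (Set.univ.pi fun _ => Set.Ioi 0) := by
    have h1 : SigmaFinite ((volume : Measure ℝ).map (fun x => |x|)) := by
      rw [map_abs_volume]
      infer_instance
    rw [volume_pi, Measure.pi_map_pi (f := fun _ x => |x|) fun _ => measurable_abs.aemeasurable,
      Measure.restrict_pi_pi]
    refine Measure.pi_eq fun s hs => ?_
    rw [Measure.smul_apply, Measure.pi_pi, map_abs_volume]
    simp [← two_mul, Finset.prod_mul_distrib]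
  have habs : Measurable fun (x : Fin d → ℝ) (i : Fin d) => |x i| := by fun_prop
  calc ∫⁻ x, F x = ∫⁻ x : Fin d → ℝ, F (fun i => |x i|) := by simp_rw [hs]
    _ = ∫⁻ x, F x ∂(volume.map fun (x : Fin d → ℝ) i => |x i|) := (lintegral_map hF habs).symm
    _ = _ := by rw [hmap, lintegral_smul_measure, smul_eq_mul]

theorem lintegral_pos_exp_neg_sum (α : ℝ) :
    ∫⁻ x : Fin d → ℝ in Set.univ.pi fun _ => Set.Ioi 0, ENNReal.ofReal (Real.exp (-(α * ∑ i, x i)))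
      = (∫⁻ x in Set.Ioi (0 : ℝ), ENNReal.ofReal (Real.exp (-α * x))) ^ d := by
  rw [volume_pi, Measure.restrict_pi_pi]
  have h := lintegral_pi_prod (n := d) (fun _ => volume.restrict (Set.Ioi (0 : ℝ)))
    (f := fun _ x => ENNReal.ofReal (Real.exp (-α * x))) (fun _ => by fun_prop)
  rw [Finset.prod_const, Finset.card_univ, Fintype.card_fin] at h
  rw [← h]
  refine lintegral_congr fun x => ?_
  rw [← ENNReal.ofReal_prod_of_nonneg fun _ _ => (Real.exp_pos _).le, ← Real.exp_sum]
  congr 2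
  rw [Finset.mul_sum, ← Finset.sum_neg_distrib]
  exact Finset.sum_congr rfl fun i _ => by ring

theorem lintegral_exp_neg_sum_abs_lt_top {α : ℝ} (hα : 0 < α) :
    ∫⁻ x : EuclideanSpace ℝ (Fin d), ENNReal.ofReal (Real.exp (-(α * ∑ i, |x i|))) < ∞ := by
  rw [← (PiLp.volume_preserving_toLp (Fin d)).lintegral_comp_emb
    (MeasurableEquiv.toLp 2 (Fin d → ℝ)).measurableEmbedding,
    lintegral_eq_two_pow_mul (by fun_prop) (fun x => by simp)]
  have h1 : ∫⁻ x : Fin d → ℝ in Set.univ.pi fun _ => Set.Ioi 0,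
      ENNReal.ofReal (Real.exp (-(α * ∑ i, |x i|))) =
      ∫⁻ x : Fin d → ℝ in Set.univ.pi fun _ => Set.Ioi 0,
      ENNReal.ofReal (Real.exp (-(α * ∑ i, x i))) := by
    refine setLIntegral_congr_fun (MeasurableSet.univ_pi fun _ => measurableSet_Ioi) ?_
    intro x hx
    have : ∑ i, |x i| = ∑ i, x i := Finset.sum_congr rfl fun i _ => abs_of_pos (hx i trivial)
    simp only [this]
  refine ENNReal.mul_lt_top (ENNReal.pow_lt_top (by simp)) ?_
  refine lt_of_eq_of_lt h1 ?_
  rw [lintegral_pos_exp_neg_sum]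
  refine ENNReal.pow_lt_top ?_
  exact (exp_neg_integrableOn_Ioi 0 hα).lintegral_lt_top

/-! ### The inverse Santaló inequality -/

/-- Comparison of two integrals through the measures of their superlevel sets. -/
theorem lintegral_le_lintegral_of_meas_lt {X Y : Type*} [MeasurableSpace X] [MeasurableSpace Y]
    {μ : Measure X} {ν : Measure Y} {u : X → ℝ} {v : Y → ℝ} (hu : Measurable u) (hv : Measurable v)
    (hu0 : ∀ x, 0 ≤ u x) (hv0 : ∀ y, 0 ≤ v y)
    (h : ∀ t > 0, μ {x | t < u x} ≤ ν {y | t < v y}) :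
    ∫⁻ x, ENNReal.ofReal (u x) ∂μ ≤ ∫⁻ y, ENNReal.ofReal (v y) ∂ν := by
  rw [lintegral_eq_lintegral_meas_lt μ (Filter.Eventually.of_forall hu0) hu.aemeasurable,
    lintegral_eq_lintegral_meas_lt ν (Filter.Eventually.of_forall hv0) hv.aemeasurable]
  exact setLIntegral_mono' measurableSet_Ioi h

theorem exp_neg_add_le_toReal_mul {g h : EuclideanSpace ℝ (Fin d) → EReal}
    {x y : EuclideanSpace ℝ (Fin d)} {r s : ℝ} (hg : g x ≠ ⊥) (hh : h y ≠ ⊥) (hx : g x ≤ r)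
    (hy : h y ≤ s) :
    Real.exp (-(r + s)) ≤ (EReal.exp (-g x) * EReal.exp (-h y)).toReal := by
  have h1 : ENNReal.ofReal (Real.exp (-(r + s))) ≤ EReal.exp (-g x) * EReal.exp (-h y) := by
    rw [neg_add, Real.exp_add, ENNReal.ofReal_mul (Real.exp_pos _).le]
    refine mul_le_mul' ?_ ?_
    · rw [← EReal.exp_coe, EReal.exp_le_exp_iff, EReal.coe_neg]
      exact EReal.neg_le_neg_iff.2 hx
    · rw [← EReal.exp_coe, EReal.exp_le_exp_iff, EReal.coe_neg]
      exact EReal.neg_le_neg_iff.2 hy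
  refine (ENNReal.ofReal_le_iff_le_toReal ?_).1 h1
  exact ENNReal.mul_ne_top (by simpa using hg) (by simpa using hh)

/-- The inverse Santaló inequality on the positive orthant. -/
theorem one_le_lintegral_pos {g h : EuclideanSpace ℝ (Fin d) → EReal}
    (hgm : Measurable g) (hhm : Measurable h) (hgb : ∀ x, g x ≠ ⊥) (hhb : ∀ y, h y ≠ ⊥)
    (hgmono : ∀ x x' : EuclideanSpace ℝ (Fin d), (∀ i, |x i| ≤ |x' i|) → g x ≤ g x')
    (hhmono : ∀ x x' : EuclideanSpace ℝ (Fin d), (∀ i, |x i| ≤ |x' i|) → h x ≤ h x')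
    (hfac : ∀ a : Fin d → ℝ, (∀ i, 0 < a i) → ∃ (x : EuclideanSpace ℝ (Fin d)) (r : ℝ),
      (∀ i, 0 < x i) ∧ g x ≤ r ∧
      h (WithLp.toLp 2 fun i => a i / x i) ≤ ((∑ i, a i - r : ℝ) : EReal)) :
    1 ≤ (∫⁻ x : Fin d → ℝ in Set.univ.pi fun _ => Set.Ioi 0, EReal.exp (-g (WithLp.toLp 2 x))) *
      ∫⁻ x : Fin d → ℝ in Set.univ.pi fun _ => Set.Ioi 0, EReal.exp (-h (WithLp.toLp 2 x)) := by
  set O : Set (Fin d → ℝ) := Set.univ.pi fun _ => Set.Ioi 0 with hO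
  have hOm : MeasurableSet O := MeasurableSet.univ_pi fun _ => measurableSet_Ioi
  set F : (Fin d → ℝ) → ℝ≥0∞ := fun x => EReal.exp (-g (WithLp.toLp 2 x)) with hF
  set G : (Fin d → ℝ) → ℝ≥0∞ := fun x => EReal.exp (-h (WithLp.toLp 2 x)) with hG
  have hFm : Measurable F :=
    EReal.measurable_exp.comp (hgm.comp (MeasurableEquiv.toLp 2 (Fin d → ℝ)).measurable).neg
  have hGm : Measurable G :=
    EReal.measurable_exp.comp (hhm.comp (MeasurableEquiv.toLp 2 (Fin d → ℝ)).measurable).neg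
  have hc1 : ∀ i, Continuous fun z : Fin d → ℝ × ℝ => (z i).1 := fun i => by fun_prop
  have hc2 : ∀ i, Continuous fun z : Fin d → ℝ × ℝ => (z i).2 := fun i => by fun_prop
  set P : Set (Fin d → ℝ × ℝ) := {z | ∀ i, 0 < (z i).1 ∧ 0 < (z i).2} with hP
  have hPm : MeasurableSet P := by
    have : P = ⋂ i, {z | 0 < (z i).1 ∧ 0 < (z i).2} := by
      ext z
      simp [hP]
    rw [this]
    refine MeasurableSet.iInter fun i => ?_
    exact (measurableSet_lt measurable_const (hc1 i).measurable).inter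
      (measurableSet_lt measurable_const (hc2 i).measurable)
  set Φ : (Fin d → ℝ × ℝ) → ℝ := fun z => (F (fun i => (z i).1) * G (fun i => (z i).2)).toReal with hΦ
  have hΦm : Measurable Φ :=
    ((hFm.comp (by fun_prop)).mul (hGm.comp (by fun_prop))).ennreal_toReal
  have hprod : (∫⁻ x in O, F x) * ∫⁻ x in O, G x =
      ∫⁻ z, ENNReal.ofReal (P.indicator Φ z) := by
    rw [← lintegral_prod_mul hFm.aemeasurable hGm.aemeasurable, Measure.prod_restrict,
      ← lintegral_indicator (hOm.prod hOm), ← Measure.volume_eq_prod,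
      ← (volume_measurePreserving_arrowProdEquivProdArrow ℝ ℝ (Fin d)).lintegral_comp_emb
        (MeasurableEquiv.measurableEmbedding _)]
    refine lintegral_congr fun z => ?_
    by_cases hz : z ∈ P
    · rw [Set.indicator_of_mem hz, Set.indicator_of_mem]
      · rw [hΦ, ENNReal.ofReal_toReal]
        · rfl
        · exact ENNReal.mul_ne_top (by simpa [hF] using hgb _) (by simpa [hG] using hhb _)
      · exact ⟨fun i _ => (hz i).1, fun i _ => (hz i).2⟩
    · rw [Set.indicator_of_notMem hz, Set.indicator_of_notMem]
      · simp
      · rintro ⟨h1, h2⟩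
        exact hz fun i => ⟨h1 i trivial, h2 i trivial⟩
  have hone : (1 : ℝ≥0∞) =
      ∫⁻ a : Fin d → ℝ, ENNReal.ofReal (O.indicator (fun a => Real.exp (-(1 * ∑ i, a i))) a) := by
    have h1 := lintegral_pos_exp_neg_sum (d := d) 1
    have h2 : ∫⁻ x in Set.Ioi (0 : ℝ), ENNReal.ofReal (Real.exp (-1 * x)) = 1 := by
      rw [← ofReal_integral_eq_lintegral_ofReal (exp_neg_integrableOn_Ioi 0 one_pos)
        (Filter.Eventually.of_forall fun _ => (Real.exp_pos _).le)]
      simp only [neg_mul, one_mul]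
      rw [integral_exp_neg_Ioi_zero, ENNReal.ofReal_one]
    rw [h2, one_pow] at h1
    rw [← h1, ← lintegral_indicator hOm]
    refine lintegral_congr fun a => ?_
    by_cases ha : a ∈ O <;> simp [ha]
  rw [hprod, hone]
  refine lintegral_le_lintegral_of_meas_lt ((by fun_prop : Measurable _).indicator hOm)
    (hΦm.indicator hPm) (fun a => Set.indicator_nonneg (fun _ _ => (Real.exp_pos _).le) a)
    (fun z => Set.indicator_nonneg (fun _ _ => ENNReal.toReal_nonneg) z) fun t ht => ?_
  -- Positive pairs strictly below a point of the superlevel set of `Φ`. Strictness makes `U` open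
  -- without semicontinuity; monotonicity keeps it inside the superlevel set.
  set U : Set (Fin d → ℝ × ℝ) :=
    {z | z ∈ P ∧ ∃ w, (∀ i, (z i).1 < (w i).1 ∧ (z i).2 < (w i).2) ∧ t < Φ w} with hU
  have hUo : IsOpen U := by
    have : U = ⋃ (w : Fin d → ℝ × ℝ) (_ : t < Φ w),
        ⋂ i, {z | (0 < (z i).1 ∧ 0 < (z i).2) ∧ (z i).1 < (w i).1 ∧ (z i).2 < (w i).2} := by
      ext z
      simp only [hU, hP, Set.mem_ofPred_eq, Set.mem_iUnion, Set.mem_iInter, exists_prop,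
        forall_and]
      tauto
    rw [this]
    refine isOpen_iUnion fun w => isOpen_iUnion fun _ => isOpen_iInter_of_finite fun i => ?_
    exact ((isOpen_lt continuous_const (hc1 i)).inter (isOpen_lt continuous_const (hc2 i))).inter
      ((isOpen_lt (hc1 i) continuous_const).inter (isOpen_lt (hc2 i) continuous_const))
  have hUL : IsPosLower U := by
    refine ⟨fun z hz => hz.1, ?_⟩
    rintro z ⟨-, w, hw, hwt⟩ z' hz' hle
    exact ⟨hz', w, fun i => ⟨(hle i).1.trans_lt (hw i).1, (hle i).2.trans_lt (hw i).2⟩, hwt⟩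
  have hUsub : U ⊆ {z | t < P.indicator Φ z} := by
    rintro z ⟨hz, w, hw, hwt⟩
    rw [Set.mem_ofPred_eq, Set.indicator_of_mem hz]
    refine hwt.trans_le (ENNReal.toReal_mono ?_ (mul_le_mul' ?_ ?_))
    · exact ENNReal.mul_ne_top (by simpa [hF] using hgb _) (by simpa [hG] using hhb _)
    · rw [hF, EReal.exp_le_exp_iff, EReal.neg_le_neg_iff]
      refine hgmono _ _ fun i => ?_
      exact abs_le_abs_of_nonneg (hz i).1.le (hw i).1.le
    · rw [hG, EReal.exp_le_exp_iff, EReal.neg_le_neg_iff]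
      refine hhmono _ _ fun i => ?_
      exact abs_le_abs_of_nonneg (hz i).2.le (hw i).2.le
  have hsub : {a | t < O.indicator (fun a : Fin d → ℝ => Real.exp (-(1 * ∑ i, a i))) a} ⊆
      mulSet U := by
    intro a ha
    rw [Set.mem_ofPred_eq] at ha
    have haO : a ∈ O := by
      by_contra hcon
      rw [Set.indicator_of_notMem hcon] at ha
      exact absurd ha (not_lt.2 ht.le)
    have ha0 : ∀ i, 0 < a i := fun i => haO i trivial
    rw [Set.indicator_of_mem haO, one_mul] at ha
    -- Slack for strictness: factor `m² a` as `x · y`. Then `(x / m, y / m)` has product `a` and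
    -- lies strictly below `(x, y)`.
    obtain ⟨m, hm1, hm⟩ : ∃ m : ℝ, 1 < m ∧ t < Real.exp (-(∑ i, m ^ 2 * a i)) := by
      have hc : Continuous fun m : ℝ => Real.exp (-(∑ i, m ^ 2 * a i)) := by fun_prop
      have hev : ∀ᶠ m in nhdsWithin (1 : ℝ) (Set.Ioi 1), t < Real.exp (-(∑ i, m ^ 2 * a i)) :=
        nhdsWithin_le_nhds (hc.continuousAt.eventually (lt_mem_nhds (by simpa using ha)))
      obtain ⟨m, hm⟩ := (hev.and self_mem_nhdsWithin).exists
      exact ⟨m, hm.2, hm.1⟩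
    have hm0 : 0 < m := one_pos.trans hm1
    obtain ⟨x, r, hx, hr, hs⟩ := hfac (fun i => m ^ 2 * a i)
      fun i => mul_pos (pow_pos hm0 2) (ha0 i)
    have hb0 : ∀ i, 0 < a i / x i := fun i => div_pos (ha0 i) (hx i)
    refine ⟨fun i => x i / m, fun i => div_pos (hx i) hm0, fun i => ?_,
      fun i => (x i, m ^ 2 * a i / x i), fun i => ⟨?_, ?_⟩, ?_⟩
    · exact ⟨div_pos (hx i) hm0, div_pos (ha0 i) (div_pos (hx i) hm0)⟩
    · exact div_lt_self (hx i) hm1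
    · have h1 : a i / (x i / m) = m * (a i / x i) := by
        have := (hx i).ne'
        field_simp
      have h2 : m ^ 2 * a i / x i = m * (m * (a i / x i)) := by ring
      simp only [h1, h2]
      have := mul_pos hm0 (hb0 i)
      nlinarith
    · refine hm.trans_le ?_
      have := exp_neg_add_le_toReal_mul (hgb x) (hhb _) hr hs
      rwa [add_sub_cancel] at this
  calc volume _ ≤ volume (mulSet U) := measure_mono hsub
    _ ≤ volume U := volume_mulSet_le U hUo hUL
    _ ≤ _ := measure_mono hUsub

theorem ne_bot_of_growth {g : EuclideanSpace ℝ (Fin d) → EReal} {α c : ℝ}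
    (hgrow : ∀ (x : EuclideanSpace ℝ (Fin d)) (r : ℝ), g x ≤ r → α * ∑ i, |x i| - c ≤ r)
    (x : EuclideanSpace ℝ (Fin d)) : g x ≠ ⊥ := by
  intro h
  have := hgrow x (α * ∑ i, |x i| - c - 1) (h ▸ bot_le)
  linarith

theorem expMass_lt_top_of_growth {g : EuclideanSpace ℝ (Fin d) → EReal} {α c : ℝ} (hα : 0 < α)
    (hgrow : ∀ (x : EuclideanSpace ℝ (Fin d)) (r : ℝ), g x ≤ r → α * ∑ i, |x i| - c ≤ r) :
    expMass g < ∞ := by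
  have h1 : ∀ x, EReal.exp (-g x) ≤
      ENNReal.ofReal (Real.exp c) * ENNReal.ofReal (Real.exp (-(α * ∑ i, |x i|))) := by
    intro x
    rw [← ENNReal.ofReal_mul (Real.exp_pos _).le, ← Real.exp_add, ← EReal.exp_coe,
      EReal.exp_le_exp_iff, EReal.neg_le, ← EReal.coe_neg]
    refine ereal_le_of_forall_coe fun r hr => EReal.coe_le_coe_iff.2 ?_
    have := hgrow x r hr
    linarith
  refine (lintegral_mono h1).trans_lt ?_
  rw [lintegral_const_mul _ (by fun_prop)]
  exact ENNReal.mul_lt_top ENNReal.ofReal_lt_top (lintegral_exp_neg_sum_abs_lt_top hα)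

/-- The inverse Santaló inequality for an unconditional pair of conjugate convex functions. -/
theorem four_pow_le_expMass_mul {g h : EuclideanSpace ℝ (Fin d) → EReal}
    (hgh : g = legendre h) (hhg : h = legendre g) (hgs : IsSignSymm g) (hhs : IsSignSymm h)
    (hpos : expMass g ≠ 0) {α c β s : ℝ} (hα : 0 < α)
    (hggrow : ∀ (x : EuclideanSpace ℝ (Fin d)) (r : ℝ), g x ≤ r → α * ∑ i, |x i| - c ≤ r)
    (hhgrow : ∀ (x : EuclideanSpace ℝ (Fin d)) (r : ℝ), h x ≤ r → β * ∑ i, |x i| - s ≤ r) :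
    4 ^ d ≤ expMass g * expMass h := by
  have hgm : Measurable g := hgh ▸ measurable_legendre
  have hhm : Measurable h := hhg ▸ measurable_legendre
  have hgmono : ∀ x x' : EuclideanSpace ℝ (Fin d), (∀ i, |x i| ≤ |x' i|) → g x ≤ g x' :=
    fun x x' hle => by rw [hgh]; exact hhs.legendre_mono hle
  have hhmono : ∀ x x' : EuclideanSpace ℝ (Fin d), (∀ i, |x i| ≤ |x' i|) → h x ≤ h x' :=
    fun x x' hle => by rw [hhg]; exact hgs.legendre_mono hle
  obtain ⟨x₀, hx₀, hgx₀⟩ := exists_pos_lt_top hgs hpos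
  obtain ⟨r₀, hr₀, -⟩ := EReal.exists_rat_btwn_of_lt hgx₀
  have hgc : IsConvexFun g := hgh ▸ isConvexFun_legendre
  have hgcl : IsClosed {p : EuclideanSpace ℝ (Fin d) × ℝ | g p.1 ≤ (p.2 : EReal)} :=
    hgh ▸ isClosed_epigraph_legendre
  have hone := one_le_lintegral_pos hgm hhm (ne_bot_of_growth hggrow) (ne_bot_of_growth hhgrow)
    hgmono hhmono fun a ha => by
      rw [hhg]
      exact exists_factorization hgc hgcl hα hggrow hx₀ hr₀.le ha
  have h2 : ∀ k : EuclideanSpace ℝ (Fin d) → EReal, Measurable k → IsSignSymm k →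
      expMass k = 2 ^ d * ∫⁻ x : Fin d → ℝ in Set.univ.pi fun _ => Set.Ioi 0,
        EReal.exp (-k (WithLp.toLp 2 x)) := by
    intro k hk hks
    rw [expMass_eq_lintegral_pi]
    refine lintegral_eq_two_pow_mul (EReal.measurable_exp.comp
      (hk.comp (MeasurableEquiv.toLp 2 (Fin d → ℝ)).measurable).neg) fun x => ?_
    congr 2
    exact hks.eq_of_abs_eq fun i => by simp
  rw [h2 g hgm hgs, h2 h hhm hhs, mul_mul_mul_comm, ← mul_pow]
  norm_num
  exact le_mul_of_one_le_right' hone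

/-! ### Gaussian density, integrability and entropy -/

theorem gaussianPDF_prod (x : Fin d → ℝ) : ∏ i, gaussianPDF 0 1 (x i) =
    ENNReal.ofReal ((Real.sqrt (2 * Real.pi))⁻¹ ^ d * Real.exp (-‖WithLp.toLp 2 x‖ ^ 2 / 2)) := by
  simp only [gaussianPDF, gaussianPDFReal]
  rw [← ENNReal.ofReal_prod_of_nonneg fun _ _ => by positivity, Finset.prod_mul_distrib,
    ← Real.exp_sum, EuclideanSpace.real_norm_sq_eq]
  simp [Finset.sum_div, neg_div]

theorem stdGaussian_eq_withDensity : stdGaussian (EuclideanSpace ℝ (Fin d)) =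
    volume.withDensity fun x => ENNReal.ofReal
      ((Real.sqrt (2 * Real.pi))⁻¹ ^ d * Real.exp (-‖x‖ ^ 2 / 2)) := by
  have h1 : Measure.pi (fun _ : Fin d => gaussianReal 0 1) =
      volume.withDensity fun x : Fin d → ℝ => ∏ i, gaussianPDF 0 1 (x i) := by
    refine Measure.pi_eq fun s hs => ?_
    rw [withDensity_apply _ (MeasurableSet.univ_pi hs), volume_pi, Measure.restrict_pi_pi,
      lintegral_pi_prod _ fun _ => measurable_gaussianPDF 0 1]
    refine Finset.prod_congr rfl fun i _ => ?_
    rw [gaussianReal_of_var_ne_zero _ one_ne_zero, withDensity_apply _ (hs i)]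
  have hmp := PiLp.volume_preserving_toLp (Fin d)
  rw [← map_pi_eq_stdGaussian, h1]
  ext s hs
  rw [Measure.map_apply hmp.measurable hs, withDensity_apply _ (hmp.measurable hs),
    withDensity_apply _ hs, ← hmp.setLIntegral_comp_preimage hs (by fun_prop)]
  simp only [gaussianPDF_prod]

theorem isProbabilityMeasure_expMeasure {g : EuclideanSpace ℝ (Fin d) → EReal}
    (hpos : expMass g ≠ 0) (hfin : expMass g ≠ ∞) : IsProbabilityMeasure (expMeasure g) := by
  refine ⟨?_⟩
  unfold expMeasure
  rw [Measure.smul_apply, withDensity_apply _ MeasurableSet.univ, Measure.restrict_univ,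
    smul_eq_mul]
  exact ENNReal.inv_mul_cancel hpos hfin

theorem ae_expMeasure_lt_top {g : EuclideanSpace ℝ (Fin d) → EReal} (hg : Measurable g) :
    ∀ᵐ x ∂expMeasure g, g x ≠ ⊤ := by
  have hexp : Measurable fun x => EReal.exp (-g x) := EReal.measurable_exp.comp hg.neg
  unfold expMeasure
  refine Measure.ae_smul_measure ?_ _
  rw [ae_withDensity_iff hexp]
  refine Filter.Eventually.of_forall fun x hx h => hx ?_
  simp [h]

/-- Half of the decay of `e^{-g}` pays for `k`; by the growth bound, the other half is dominated by
`e^{-(α/2) ∑ |xᵢ|}`. -/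
theorem integrable_expMeasure {g : EuclideanSpace ℝ (Fin d) → EReal} (hg : Measurable g)
    (hpos : expMass g ≠ 0) {α c : ℝ} (hα : 0 < α)
    (hgrow : ∀ (x : EuclideanSpace ℝ (Fin d)) (r : ℝ), g x ≤ r → α * ∑ i, |x i| - c ≤ r)
    {k : EuclideanSpace ℝ (Fin d) → ℝ} (hk : Measurable k) {C : ℝ} (hC : 0 ≤ C)
    (hkC : ∀ (x : EuclideanSpace ℝ (Fin d)) (r : ℝ), g x = r →
      |k x| ≤ C * Real.exp ((r + c) / 2)) :
    Integrable k (expMeasure g) := by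
  refine ⟨hk.aestronglyMeasurable, ?_⟩
  unfold HasFiniteIntegral expMeasure
  have hexp : Measurable fun x => EReal.exp (-g x) := EReal.measurable_exp.comp hg.neg
  rw [lintegral_smul_measure, lintegral_withDensity_eq_lintegral_mul _ hexp (by fun_prop)]
  refine ENNReal.mul_lt_top (ENNReal.inv_lt_top.2 (pos_iff_ne_zero.2 hpos)) ?_
  have hb : ∀ x, EReal.exp (-g x) * ‖k x‖ₑ ≤ ENNReal.ofReal (C * Real.exp c) *
      ENNReal.ofReal (Real.exp (-(α / 2 * ∑ i, |x i|))) := by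
    intro x
    have hbot := ne_bot_of_growth hgrow x
    induction hgx : g x with
    | bot => exact absurd hgx hbot
    | top => simp
    | coe r =>
      have h1 := hkC x r hgx
      have h2 := hgrow x r hgx.le
      rw [← EReal.coe_neg, EReal.exp_coe, Real.enorm_eq_ofReal_abs,
        ← ENNReal.ofReal_mul (Real.exp_pos _).le, ← ENNReal.ofReal_mul (by positivity)]
      refine ENNReal.ofReal_le_ofReal ?_
      calc Real.exp (-r) * |k x| ≤ Real.exp (-r) * (C * Real.exp ((r + c) / 2)) :=
            mul_le_mul_of_nonneg_left h1 (Real.exp_pos _).le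
        _ = C * Real.exp c * Real.exp (-(r + c) / 2) := by
            have : Real.exp (-r) * Real.exp ((r + c) / 2) =
                Real.exp c * Real.exp (-(r + c) / 2) := by
              rw [← Real.exp_add, ← Real.exp_add]
              congr 1
              ring
            linear_combination C * this
        _ ≤ _ := by
            refine mul_le_mul_of_nonneg_left (Real.exp_le_exp.2 ?_) (by positivity)
            linarith
  refine (lintegral_mono hb).trans_lt ?_
  rw [lintegral_const_mul _ (by fun_prop)]
  exact ENNReal.mul_lt_top ENNReal.ofReal_lt_top
    (lintegral_exp_neg_sum_abs_lt_top (half_pos hα))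

theorem integrable_toReal_expMeasure {g : EuclideanSpace ℝ (Fin d) → EReal} (hg : Measurable g)
    (hpos : expMass g ≠ 0) {α c : ℝ} (hα : 0 < α)
    (hgrow : ∀ (x : EuclideanSpace ℝ (Fin d)) (r : ℝ), g x ≤ r → α * ∑ i, |x i| - c ≤ r) :
    Integrable (fun x => (g x).toReal) (expMeasure g) := by
  -- From `|r| ≤ (r + c) + |c|`, `r + c ≤ 2 e^{(r+c)/2}` and `1 ≤ e^{(r+c)/2}`.
  refine integrable_expMeasure hg hpos hα hgrow hg.ereal_toReal (C := |c| + 2) (by positivity) ?_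
  intro x r hr
  rw [hr, EReal.toReal_coe]
  have h0 : 0 ≤ α * ∑ i, |x i| := by positivity
  have h1 := hgrow x r hr.le
  have h2 := Real.add_one_le_exp ((r + c) / 2)
  have h3 : 1 ≤ Real.exp ((r + c) / 2) := Real.one_le_exp (by linarith)
  have h4 : |r| ≤ (r + c) + |c| := by
    calc |r| = |(r + c) + -c| := by congr 1; ring
      _ ≤ |r + c| + |-c| := abs_add_le _ _
      _ = (r + c) + |c| := by rw [abs_neg, abs_of_nonneg (by linarith)]
  nlinarith [abs_nonneg c]

theorem norm_le_sum_abs (x : EuclideanSpace ℝ (Fin d)) : ‖x‖ ≤ ∑ i, |x i| := by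
  have h0 : 0 ≤ ∑ i, |x i| := by positivity
  rw [← pow_le_pow_iff_left₀ (norm_nonneg _) h0 two_ne_zero, EuclideanSpace.real_norm_sq_eq]
  have := Finset.sum_sq_le_sq_sum_of_nonneg (s := Finset.univ) (f := fun i => |x i|)
    fun i _ => abs_nonneg _
  simpa using this

theorem integrable_norm_sq_expMeasure {g : EuclideanSpace ℝ (Fin d) → EReal} (hg : Measurable g)
    (hpos : expMass g ≠ 0) {α c : ℝ} (hα : 0 < α)
    (hgrow : ∀ (x : EuclideanSpace ℝ (Fin d)) (r : ℝ), g x ≤ r → α * ∑ i, |x i| - c ≤ r) :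
    Integrable (fun x => ‖x‖ ^ 2) (expMeasure g) := by
  -- From `α‖x‖ ≤ r + c` and `u² / 2 ≤ e^u` at `u = (r + c) / 2`.
  refine integrable_expMeasure hg hpos hα hgrow (by fun_prop) (C := 8 / α ^ 2) (by positivity) ?_
  intro x r hr
  have h1 := hgrow x r hr.le
  have h2 := norm_le_sum_abs x
  have h3 : α * ‖x‖ ≤ r + c := by nlinarith
  have h4 : 0 ≤ α * ‖x‖ := by positivity
  have h5 := Real.quadratic_le_exp_of_nonneg (x := (r + c) / 2) (by linarith)
  rw [abs_of_nonneg (by positivity), div_mul_eq_mul_div, le_div_iff₀ (by positivity)]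
  have h6 : (α * ‖x‖) ^ 2 ≤ (r + c) ^ 2 := pow_le_pow_left₀ h4 h3 2
  nlinarith

theorem expMeasure_eq_withDensity_stdGaussian {g : EuclideanSpace ℝ (Fin d) → EReal}
    (hg : Measurable g) :
    expMeasure g = (stdGaussian (EuclideanSpace ℝ (Fin d))).withDensity fun x =>
      (expMass g)⁻¹ * EReal.exp (-g x) * (ENNReal.ofReal
        ((Real.sqrt (2 * Real.pi))⁻¹ ^ d * Real.exp (-‖x‖ ^ 2 / 2)))⁻¹ := by
  have hexp : Measurable fun x => EReal.exp (-g x) := EReal.measurable_exp.comp hg.neg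
  rw [stdGaussian_eq_withDensity, ← withDensity_mul _ (by fun_prop) (by fun_prop), expMeasure,
    ← withDensity_smul _ hexp]
  congr 1
  funext x
  simp only [Pi.smul_apply, Pi.mul_apply, smul_eq_mul]
  rw [mul_comm (ENNReal.ofReal _), mul_assoc, ENNReal.inv_mul_cancel, mul_one]
  · rw [Ne, ENNReal.ofReal_eq_zero, not_le]
    positivity
  · exact ENNReal.ofReal_ne_top

theorem log_density {Z : ℝ≥0∞} (hpos : Z ≠ 0) (hfin : Z ≠ ∞) (r q : ℝ) :
    Real.log (Z⁻¹ * EReal.exp (-(r : EReal)) * (ENNReal.ofReal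
        ((Real.sqrt (2 * Real.pi))⁻¹ ^ d * Real.exp (-q / 2)))⁻¹).toReal =
      -r + q / 2 + (d / 2 * Real.log (2 * Real.pi) - Real.log Z.toReal) := by
  have hz : 0 < Z.toReal := ENNReal.toReal_pos hpos hfin
  have hs : 0 < Real.sqrt (2 * Real.pi) := by positivity
  rw [← EReal.coe_neg, EReal.exp_coe, ENNReal.toReal_mul, ENNReal.toReal_mul, ENNReal.toReal_inv,
    ENNReal.toReal_inv, ENNReal.toReal_ofReal (Real.exp_pos _).le,
    ENNReal.toReal_ofReal (by positivity), Real.log_mul (by positivity) (by positivity),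
    Real.log_mul (by positivity) (by positivity), Real.log_inv, Real.log_inv, Real.log_exp,
    Real.log_mul (by positivity) (by positivity), Real.log_exp, Real.log_pow, Real.log_inv,
    Real.log_sqrt (by positivity)]
  ring

/-- The Gaussian entropy of the normalized measure with density proportional to `e^{-g}`. -/
theorem gaussianEntropy_expMeasure {g : EuclideanSpace ℝ (Fin d) → EReal} (hg : Measurable g)
    (hpos : expMass g ≠ 0) (hfin : expMass g ≠ ∞) {α c : ℝ} (hα : 0 < α)
    (hgrow : ∀ (x : EuclideanSpace ℝ (Fin d)) (r : ℝ), g x ≤ r → α * ∑ i, |x i| - c ≤ r) :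
    gaussianEntropy (expMeasure g) ≠ ∞ ∧
    (gaussianEntropy (expMeasure g)).toReal = -∫ x, (g x).toReal ∂expMeasure g +
      (∫ x, ‖x‖ ^ 2 ∂expMeasure g) / 2 +
      (d / 2 * Real.log (2 * Real.pi) - Real.log (expMass g).toReal) := by
  have hprob := isProbabilityMeasure_expMeasure hpos hfin
  have hdens := expMeasure_eq_withDensity_stdGaussian hg
  have hac : expMeasure g ≪ stdGaussian (EuclideanSpace ℝ (Fin d)) := by
    rw [hdens]
    exact withDensity_absolutelyContinuous _ _
  have hrn := Measure.rnDeriv_withDensity (stdGaussian (EuclideanSpace ℝ (Fin d)))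
    (f := fun x => (expMass g)⁻¹ * EReal.exp (-g x) * (ENNReal.ofReal
        ((Real.sqrt (2 * Real.pi))⁻¹ ^ d * Real.exp (-‖x‖ ^ 2 / 2)))⁻¹) (by fun_prop)
  rw [← hdens] at hrn
  have hllr : llr (expMeasure g) (stdGaussian (EuclideanSpace ℝ (Fin d))) =ᵐ[expMeasure g]
      fun x => -(g x).toReal + ‖x‖ ^ 2 / 2 +
        (d / 2 * Real.log (2 * Real.pi) - Real.log (expMass g).toReal) := by
    filter_upwards [hac.ae_le hrn, ae_expMeasure_lt_top hg] with x hx htop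
    rw [llr, hx]
    have hcoe := EReal.coe_toReal htop (ne_bot_of_growth hgrow x)
    conv_lhs => rw [← hcoe]
    exact log_density hpos hfin _ _
  have hi1 : Integrable (fun x => -(g x).toReal) (expMeasure g) :=
    (integrable_toReal_expMeasure hg hpos hα hgrow).neg
  have hi2 := (integrable_norm_sq_expMeasure hg hpos hα hgrow).div_const 2
  have hi3 := integrable_const (μ := expMeasure g)
    (d / 2 * Real.log (2 * Real.pi) - Real.log (expMass g).toReal)
  have hint : Integrable (llr (expMeasure g) (stdGaussian (EuclideanSpace ℝ (Fin d))))
      (expMeasure g) := (integrable_congr hllr).2 ((hi1.add hi2).add hi3)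
  refine ⟨klDiv_ne_top hac hint, ?_⟩
  unfold gaussianEntropy
  rw [toReal_klDiv_of_measure_eq hac (by simp), integral_congr_ae hllr,
    integral_add (by exact hi1.add hi2) hi3, integral_add hi1 hi2, integral_div, integral_neg]
  simp

/-! ### Transport cost and the final estimate -/

theorem ofReal_integral_le_lintegral {X : Type*} [MeasurableSpace X] {p : Measure X} {q : X → ℝ}
    (hq : Integrable q p) : ENNReal.ofReal (∫ x, q x ∂p) ≤ ∫⁻ x, ENNReal.ofReal (q x) ∂p := by
  refine ENNReal.ofReal_le_of_le_toReal ?_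
  rw [integral_eq_lintegral_pos_part_sub_lintegral_neg_part hq]
  exact sub_le_self _ ENNReal.toReal_nonneg

theorem wassersteinTwo_sq (μ ν : Measure (EuclideanSpace ℝ (Fin d))) :
    wassersteinTwo μ ν ^ 2 = ⨅ p ∈ couplings μ ν, ∫⁻ z, edist z.1 z.2 ^ 2 ∂p := by
  rw [wassersteinTwo, ← ENNReal.rpow_natCast, ← ENNReal.rpow_mul]
  norm_num

/-- The transport cost is bounded below through any pair of potentials `φ, ψ` with
`⟨x, y⟩ ≤ φ x + ψ y`. -/
theorem ofReal_le_wassersteinTwo_sq {μ ν : Measure (EuclideanSpace ℝ (Fin d))}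
    {φ ψ : EuclideanSpace ℝ (Fin d) → ℝ} (hφ : Integrable φ μ) (hψ : Integrable ψ ν)
    (hμ2 : Integrable (fun x => ‖x‖ ^ 2) μ) (hν2 : Integrable (fun x => ‖x‖ ^ 2) ν)
    {A B : Set (EuclideanSpace ℝ (Fin d))} (hA : ∀ᵐ x ∂μ, x ∈ A) (hB : ∀ᵐ y ∂ν, y ∈ B)
    (hle : ∀ x ∈ A, ∀ y ∈ B, inner ℝ x y ≤ φ x + ψ y) :
    ENNReal.ofReal (∫ x, ‖x‖ ^ 2 ∂μ + ∫ y, ‖y‖ ^ 2 ∂ν - 2 * (∫ x, φ x ∂μ + ∫ y, ψ y ∂ν)) ≤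
      wassersteinTwo μ ν ^ 2 := by
  rw [wassersteinTwo_sq]
  refine le_iInf₂ fun p hp => ?_
  obtain ⟨rfl, rfl⟩ := hp
  have hf : AEMeasurable Prod.fst p := measurable_fst.aemeasurable
  have hs : AEMeasurable Prod.snd p := measurable_snd.aemeasurable
  rw [integral_map hf hφ.1, integral_map hs hψ.1, integral_map hf hμ2.1, integral_map hs hν2.1]
  have h1 := hφ.comp_measurable measurable_fst
  have h2 := hψ.comp_measurable measurable_snd
  have h3 := hμ2.comp_measurable measurable_fst
  have h4 := hν2.comp_measurable measurable_snd
  simp only [Function.comp_def] at h1 h2 h3 h4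
  have h12 : Integrable (fun z => 2 * (φ z.1 + ψ z.2)) p := (h1.add h2).const_mul 2
  have h34 : Integrable (fun z => ‖z.1‖ ^ 2 + ‖z.2‖ ^ 2) p := h3.add h4
  have heq := ofReal_integral_le_lintegral (h34.sub h12)
  simp only [Pi.sub_apply] at heq
  rw [integral_sub h34 h12, integral_add h3 h4, integral_const_mul, integral_add h1 h2] at heq
  refine heq.trans (lintegral_mono_ae ?_)
  filter_upwards [ae_of_ae_map hf hA, ae_of_ae_map hs hB] with z hz1 hz2
  rw [edist_dist, ← ENNReal.ofReal_pow dist_nonneg, dist_eq_norm, norm_sub_sq_real]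
  refine ENNReal.ofReal_le_ofReal ?_
  have := hle _ hz1 _ hz2
  linarith

theorem gaussianEntropy_add_le {g h : EuclideanSpace ℝ (Fin d) → EReal}
    (hgh : g = legendre h) (hhg : h = legendre g) (hgs : IsSignSymm g) (hhs : IsSignSymm h)
    (hpos : expMass g ≠ 0) (hfin : expMass g ≠ ∞) :
    (0 < expMass h ∧ expMass h < ∞) ∧
    gaussianEntropy (expMeasure g) + gaussianEntropy (expMeasure h) ≤
      (1 / 2 : ℝ≥0∞) * wassersteinTwo (expMeasure g) (expMeasure h) ^ 2 +
        ENNReal.ofReal ((d : ℝ) * Real.log (Real.pi / 2)) := by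
  have hgm : Measurable g := hgh ▸ measurable_legendre
  have hhm : Measurable h := hhg ▸ measurable_legendre
  have hhc : IsConvexFun h := hhg ▸ isConvexFun_legendre
  obtain ⟨y₀, hy₀, hhy₀⟩ := exists_pos_legendre_lt_top hgh hhc hhs hpos hfin
  obtain ⟨s, hs, -⟩ := EReal.exists_rat_btwn_of_lt hhy₀
  obtain ⟨x₀, hx₀, hgx₀⟩ := exists_pos_lt_top hgs hpos
  obtain ⟨c, hc, -⟩ := EReal.exists_rat_btwn_of_lt hgx₀
  obtain ⟨α, hα, hggrow⟩ := hhs.exists_growth hy₀ hs.le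
  obtain ⟨β, hβ, hhgrow⟩ := hgs.exists_growth hx₀ hc.le
  rw [← hgh] at hggrow
  rw [← hhg] at hhgrow
  have hsant := four_pow_le_expMass_mul hgh hhg hgs hhs hpos hα hggrow hhgrow
  have hhpos : expMass h ≠ 0 := by
    intro h0
    rw [h0, mul_zero] at hsant
    exact absurd hsant (by simp)
  have hhfin := expMass_lt_top_of_growth hβ hhgrow
  refine ⟨⟨pos_iff_ne_zero.2 hhpos, hhfin⟩, ?_⟩
  obtain ⟨hgt, hge⟩ := gaussianEntropy_expMeasure hgm hpos hfin hα hggrow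
  obtain ⟨hht, hhe⟩ := gaussianEntropy_expMeasure hhm hhpos hhfin.ne hβ hhgrow
  have hW := ofReal_le_wassersteinTwo_sq (integrable_toReal_expMeasure hgm hpos hα hggrow)
    (integrable_toReal_expMeasure hhm hhpos hβ hhgrow)
    (integrable_norm_sq_expMeasure hgm hpos hα hggrow)
    (integrable_norm_sq_expMeasure hhm hhpos hβ hhgrow)
    -- `EReal.toReal` sends `⊤` to `0`, so Fenchel–Young for the real potentials is only claimed
    -- where both functions are finite.
    (A := {x | g x ≠ ⊤}) (B := {y | h y ≠ ⊤})
    (ae_expMeasure_lt_top hgm) (ae_expMeasure_lt_top hhm) fun x hx y hy => by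
      refine inner_le_of_legendre_le (f := g)
        (EReal.coe_toReal hx (ne_bot_of_growth hggrow x)).ge ?_
      rw [← hhg]
      exact (EReal.coe_toReal hy (ne_bot_of_growth hhgrow y)).ge
  have hzg : 0 < (expMass g).toReal := ENNReal.toReal_pos hpos hfin
  have hzh : 0 < (expMass h).toReal := ENNReal.toReal_pos hhpos hhfin.ne
  have hlog : d * Real.log 4 ≤ Real.log (expMass g).toReal + Real.log (expMass h).toReal := by
    rw [← Real.log_mul hzg.ne' hzh.ne', ← Real.log_pow, ← ENNReal.toReal_mul]
    refine Real.log_le_log (by positivity) ?_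
    have := ENNReal.toReal_mono (ENNReal.mul_ne_top hfin hhfin.ne) hsant
    simpa using this
  have hconst : d / 2 * Real.log (2 * Real.pi) - Real.log (expMass g).toReal +
      (d / 2 * Real.log (2 * Real.pi) - Real.log (expMass h).toReal) ≤
      d * Real.log (Real.pi / 2) := by
    have h1 : Real.log (Real.pi / 2) = Real.log (2 * Real.pi) - Real.log 4 := by
      rw [← Real.log_div (by positivity) (by norm_num)]
      congr 1
      ring
    rw [h1]
    linarith
  rw [← ENNReal.ofReal_toReal hgt, ← ENNReal.ofReal_toReal hht,
    ← ENNReal.ofReal_add ENNReal.toReal_nonneg ENNReal.toReal_nonneg, hge, hhe]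
  set Q := ∫ x, ‖x‖ ^ 2 ∂expMeasure g + ∫ y, ‖y‖ ^ 2 ∂expMeasure h -
    2 * (∫ x, (g x).toReal ∂expMeasure g + ∫ y, (h y).toReal ∂expMeasure h) with hQ
  have hhalf : ENNReal.ofReal (1 / 2 * Q) = 1 / 2 * ENNReal.ofReal Q := by
    rw [ENNReal.ofReal_mul (by norm_num), ENNReal.ofReal_div_of_pos two_pos]
    simp
  calc _ ≤ ENNReal.ofReal (1 / 2 * Q + d * Real.log (Real.pi / 2)) :=
        ENNReal.ofReal_le_ofReal (by rw [hQ]; linarith)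
    _ ≤ ENNReal.ofReal (1 / 2 * Q) + ENNReal.ofReal (d * Real.log (Real.pi / 2)) :=
        ENNReal.ofReal_add_le
    _ ≤ _ := by
        rw [hhalf]
        gcongr

end ReverseTalagrand

theorem mainTheorem5 (d : ℕ) (f : EuclideanSpace ℝ (Fin d) → EReal)
    (hf_bot : ∀ x, f x ≠ ⊥)
    (hf_conv : ReverseTalagrand.IsConvexFun f)
    (hf_pos : 0 < ReverseTalagrand.expMass f)
    (hf_fin : ReverseTalagrand.expMass f < ∞)
    (hf_unc : ReverseTalagrand.IsUnconditional (ReverseTalagrand.expMeasure f)) :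
    (0 < ReverseTalagrand.expMass (ReverseTalagrand.legendre f) ∧
      ReverseTalagrand.expMass (ReverseTalagrand.legendre f) < ∞) ∧
    ReverseTalagrand.gaussianEntropy (ReverseTalagrand.expMeasure f) +
        ReverseTalagrand.gaussianEntropy
          (ReverseTalagrand.expMeasure (ReverseTalagrand.legendre f)) ≤
      (1 / 2 : ℝ≥0∞) *
          ReverseTalagrand.wassersteinTwo (ReverseTalagrand.expMeasure f)
            (ReverseTalagrand.expMeasure (ReverseTalagrand.legendre f)) ^ 2 +
        ENNReal.ofReal ((d : ℝ) * Real.log (Real.pi / 2)) := by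
  open ReverseTalagrand in
  -- Replacing `f` by `f**` changes neither mass nor measure, and makes the pair exactly conjugate
  -- and, through `f* = f***`, exactly symmetric.
  have hae := legendre_legendre_ae_eq hf_bot hf_conv hf_pos.ne'
  have hexp : (fun x => EReal.exp (-legendre (legendre f) x)) =ᵐ[volume]
      fun x => EReal.exp (-f x) := hae.mono fun x hx => by simp only [hx]
  have hmass : expMass (legendre (legendre f)) = expMass f := lintegral_congr_ae hexp
  have hmeas : ReverseTalagrand.expMeasure (legendre (legendre f)) =
      ReverseTalagrand.expMeasure f := by
    rw [ReverseTalagrand.expMeasure, ReverseTalagrand.expMeasure, hmass, withDensity_congr_ae hexp]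
  rw [← hmass] at hf_pos hf_fin
  rw [← hmeas] at hf_unc ⊢
  have hh : legendre f = legendre (legendre (legendre f)) := legendre_legendre_legendre.symm
  have hhs : IsSignSymm (legendre f) := by
    rw [hh]
    exact isSignSymm_legendre_of_ae isConvexFun_legendre hf_pos.ne'
      (ae_eq_comp_coordReflection measurable_legendre hf_pos.ne' hf_fin.ne hf_unc)
  exact gaussianEntropy_add_le rfl hh hhs.legendre hhs hf_pos.ne' hf_fin.ne
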